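/- **Model.** Let $\mathbb X$ (states) and $\mathbb A$ (actions) be Borel subsets of Polish spaces. For each $x\in\mathbb X$ let $A(x)\subseteq\mathbb A$ be a nonempty set of available actions such that the graph $\mathrm{Gr}(A)=\{(x,a):x\in\mathbb X,\ a\in A(x)\}$ is Borel in $\mathbb X\times\mathbb A$ and there is a Borel map $\phi:\mathbb X\to\mathbb A$ with $\phi(x)\in A(x)$ for all $x$. Let the cost $c:\mathrm{Gr}(A)\to(-\infty,+\infty]$ be Borel and bounded below, and let $q(\cdot\mid x,a)$ be probability measures on $\mathbb X$ such that $q(B\mid\cdot,\cdot)$ is Borel on $\mathrm{Gr}(A)$ for every Borel $B\subseteq\mathbb X$. A policy $\pi=(\pi_n)_{n\ge0}$ is a sequence of transition probabilities $\pi_n$ from the histories $(\mathbb X\times\mathbb A)^n\times\mathbb X$ to $\mathbb A$ with $\pi_n(A(x_n)\mid x_0,a_0,\dots,a_{n-1},x_n)=1$. A stationary policy is a Borel map $\phi:\mathbb X\to\mathbb A$ with $\phi(x)\in A(x)$ for all $x$, identified with the policy that chooses $\phi(x_n)$ at each time $n$. Let $\mathbb E_x^\pi$ be the expectation for the law on trajectories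 $(x_0,a_0,x_1,a_1,\dots)$ determined by $x_0=x$, $\pi$ and $q$. Put $$v_N^\pi(x)=\mathbb E_x^\pi\sum_{n=0}^{N-1}c(x_n,a_n),\quad v_\alpha^\pi(x)=\mathbb E_x^\pi\sum_{n=0}^{\infty}\alpha^nc(x_n,a_n)\ (0\le\alpha<1),\quad w^\pi(x)=\limsup_{N\to\infty}\tfrac1N v_N^\pi(x),$$ $v_\alpha(x)=\inf_\pi v_\alpha^\pi(x)$, $w(x)=\inf_\pi w^\pi(x)$, $w^*=\inf_{x}w(x)$, $m_\alpha=\inf_xv_\alpha(x)$, $u_\alpha(x)=v_\alpha(x)-m_\alpha$, $\overline w=\limsup_{\alpha\uparrow1}(1-\alpha)m_\alpha$. A policy $\pi$ is average-cost optimal if $w^\pi(x)=w(x)$ for all $x$. A function is inf-compact if all its level sets $\{f\le\lambda\}$, $\lambda\in\mathbb R$, are compact. **Assumptions.** * $(\mathbf W^*)$: (i) $c$ is lower semicontinuous and bounded below on $\mathrm{Gr}(A)$; (ii) if $x_n\to x$ in $\mathbb X$, $a_n\in A(x_n)$ and the sequence $c(x_n,a_n)$ is bounded above, then $(a_n)$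 has a limit point in $A(x)$; (iii) $q(\cdot\mid x,a)$ is weakly continuous in $(x,a)\in\mathrm{Gr}(A)$. * $(\underline{\mathbf B})$: $w^*<\infty$, and $\liminf_{\alpha\uparrow1}u_\alpha(x)<\infty$ for all $x\in\mathbb X$. * $(\mathbf{Wu})$: $c$ is inf-compact on $\mathrm{Gr}(A)$, and $(\mathbf W^*)$(iii) holds. **Theorem.** Suppose $(\mathbf W^*)$ and $(\underline{\mathbf B})$ hold. Define, for $x\in\mathbb X$, $$u(x)=\liminf_{\alpha\uparrow1,\ y\to x}u_\alpha(y)=\sup_{\beta\in[0,1),\,R>0}\ \inf\{u_\alpha(y):\alpha\in[\beta,1),\ y\in B_R(x)\},$$ $$A^*(x)=\Big\{a\in A(x):\ \overline w+u(x)\ge c(x,a)+\int u(y)\,q(dy\mid x,a)\Big\},$$ $$A_*(x)=\Big\{a\in A(x):\ c(x,a)+\int u(y)\,q(dy\mid x,a)=\inf_{b\in A(x)}\Big[c(x,b)+\int u(y)\,q(dy\mid x,b)\Big]\Big\}.$$ Then there exists a stationary policy $\phi$ with $$\overline w+u(x)\ge c(x,\phi(x))+\int u(y)\,q(dy\mid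 x,\phi(x)),\qquad x\in\mathbb X,\tag{1}$$ which is average-cost optimal and satisfies $$w(x)=w^\phi(x)=\limsup_{\alpha\uparrow1}(1-\alpha)v_\alpha(x)=\overline w=w^*,\qquad x\in\mathbb X.\tag{2}$$ Furthermore: (a) $u$ takes values in $[0,\infty)$ and is lower semicontinuous; (b) the sets $A^*(x)$, $x\in\mathbb X$, are nonempty and compact, and the graph $\{(x,a):x\in\mathbb X,\ a\in A^*(x)\}$ is a Borel subset of $\mathbb X\times\mathbb A$; (c) every stationary policy $\phi$ with $\phi(x)\in A^*(x)$ for all $x\in\mathbb X$ is average-cost optimal and satisfies (1) and (2); (d) $A_*(x)\subseteq A^*(x)$ for all $x\in\mathbb X$, and there exists a stationary policy $\phi$ with $\phi(x)\in A_*(x)$ for all $x\in\mathbb X$; (e) if, in addition, $(\mathbf{Wu})$ holds, then $u$ is inf-compact. -/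

import Mathlib

open MeasureTheory ProbabilityTheory Filter Topology
open scoped ENNReal BoundedContinuousFunction

/-- Lebesgue integral of an extended-real function: the integral of the positive part minus the
integral of the negative part. It is used only where the integral of the negative part is
finite. -/
noncomputable def extIntegral {Ω : Type*} [MeasurableSpace Ω] (μ : Measure Ω) (f : Ω → EReal) :
    EReal :=
  ((∫⁻ ω, (f ω).toENNReal ∂μ : ℝ≥0∞) : EReal) - ((∫⁻ ω, (-f ω).toENNReal ∂μ : ℝ≥0∞) : EReal)

/-- Sum of a series of extended reals: the sum of the positive parts minus the sum of the negative
parts. It is used only where the sum of the negative parts is finite. -/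
noncomputable def extSum (f : ℕ → EReal) : EReal :=
  ((∑' n, (f n).toENNReal : ℝ≥0∞) : EReal) - ((∑' n, (-f n).toENNReal : ℝ≥0∞) : EReal)

/-- All level sets `{y ∈ s | f y ≤ r}`, `r` real, are compact. -/
def InfCompactOn {S : Type*} [TopologicalSpace S] (f : S → EReal) (s : Set S) : Prop :=
  ∀ r : ℝ, IsCompact {y | y ∈ s ∧ f y ≤ (r : EReal)}

/-- A discrete-time Markov decision process with states `X` and actions `A`. The values of `cost`
outside the graph of `actions` are irrelevant. -/
structure MDP (X A : Type*) [MeasurableSpace X] [MeasurableSpace A] where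
  /-- the set of actions available in a state -/
  actions : X → Set A
  measurableSet_graph : MeasurableSet {p : X × A | p.2 ∈ actions p.1}
  exists_selector : ∃ φ : X → A, Measurable φ ∧ ∀ x, φ x ∈ actions x
  /-- the one-step cost, with values in `(-∞, +∞]` on the graph -/
  cost : X × A → EReal
  measurable_cost : Measurable fun p : {p : X × A | p.2 ∈ actions p.1} => cost p
  cost_bddBelow : ∃ K : ℝ, ∀ p : X × A, p.2 ∈ actions p.1 → (K : EReal) ≤ cost p
  /-- the transition probabilities -/
  trans : X × A → Measure X
  isProbabilityMeasure_trans : ∀ p, IsProbabilityMeasure (trans p)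
  measurable_trans : ∀ B : Set X, MeasurableSet B →
    Measurable fun p : {p : X × A | p.2 ∈ actions p.1} => trans p B

namespace MDP

variable {X A : Type*} [MeasurableSpace X] [MeasurableSpace A]

/-- The graph `Gr(A)`. -/
def graph (M : MDP X A) : Set (X × A) := {p | p.2 ∈ M.actions p.1}

open Classical in
/-- The transition probabilities on the graph, as a kernel on `X × A`. Off the graph, where the
process never is, the state is kept. -/
noncomputable def transKernel (M : MDP X A) : Kernel (X × A) X where
  toFun p := if p ∈ M.graph then M.trans p else Measure.dirac p.1
  measurable' := by
    refine Measure.measurable_of_measurable_coe _ fun B hB => ?_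
    have hG : MeasurableSet M.graph := M.measurableSet_graph
    refine measurable_of_restrict_of_restrict_compl hG ?_ ?_
    · have h : Measurable fun p : M.graph => M.trans p B := M.measurable_trans B hB
      refine (congrArg Measurable (funext fun p => ?_)).mp h
      exact congrArg (fun μ : Measure X => μ B) (if_pos p.2).symm
    · have h : Measurable fun p : ↥(M.graph)ᶜ => Measure.dirac (p : X × A).1 B :=
        (Measure.measurable_coe hB).comp
          (Measure.measurable_dirac.comp (measurable_fst.comp measurable_subtype_coe))
      refine (congrArg Measurable (funext fun p => ?_)).mp h
      exact congrArg (fun μ : Measure X => μ B) (if_neg p.2).symm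

instance (M : MDP X A) : IsMarkovKernel M.transKernel where
  isProbabilityMeasure p := by
    classical
    change IsProbabilityMeasure (if p ∈ M.graph then M.trans p else Measure.dirac p.1)
    split_ifs
    · exact M.isProbabilityMeasure_trans p
    · infer_instance

/-- A (randomized, history-dependent) policy: at each epoch `n` a stochastic kernel from the
histories `(X × A)^n × X` to the actions, concentrated on the actions available in the current
state. -/
structure Policy (M : MDP X A) where
  rule : (n : ℕ) → Kernel ((Fin n → X × A) × X) A
  isMarkovKernel_rule : ∀ n, IsMarkovKernel (rule n)
  rule_actions : ∀ n h, rule n h (M.actions h.2) = 1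

/-- A stationary policy: a measurable selector of `actions`. -/
structure StationaryPolicy (M : MDP X A) where
  toFun : X → A
  measurable : Measurable toFun
  mem_actions : ∀ x, toFun x ∈ M.actions x

/-- The policy that always chooses the action `φ x` in the state `x`. -/
noncomputable def StationaryPolicy.toPolicy {M : MDP X A} (φ : M.StationaryPolicy) :
    M.Policy where
  rule n := Kernel.deterministic (fun h : (Fin n → X × A) × X => φ.toFun h.2)
    (φ.measurable.comp measurable_snd)
  isMarkovKernel_rule _ := inferInstance
  rule_actions n h := by
    have hm : MeasurableSet (M.actions h.2) :=
      M.measurableSet_graph.preimage measurable_prodMk_left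
    rw [Kernel.deterministic_apply' _ _ hm]
    simp [φ.mem_actions]

/-- Joint law of the next state and the next action, given the states and actions up to time
`n`. -/
noncomputable def stepKernel (M : MDP X A) (π : M.Policy) (n : ℕ) :
    Kernel ((i : Finset.Iic n) → X × A) (X × A) :=
  (M.transKernel.comap (fun h : (i : Finset.Iic n) → X × A => h ⟨n, Finset.mem_Iic.2 le_rfl⟩)
      (measurable_pi_apply _)) ⊗ₖ
    ((π.rule (n + 1)).comap
      (fun p : ((i : Finset.Iic n) → X × A) × X =>
        ((fun i : Fin (n + 1) => p.1 ⟨i, Finset.mem_Iic.2 (Nat.lt_succ_iff.1 i.2)⟩), p.2))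
      (by fun_prop))

instance (M : MDP X A) (π : M.Policy) (n : ℕ) : IsMarkovKernel (M.stepKernel π n) := by
  have := π.isMarkovKernel_rule (n + 1)
  unfold stepKernel
  infer_instance

/-- Law of the initial state-action pair when the initial state is `x`. -/
noncomputable def initialLaw (M : MDP X A) (π : M.Policy) (x : X) : Measure (X × A) :=
  (π.rule 0 (Fin.elim0, x)).map fun a => (x, a)

/-- The probability `P_x^π` on the trajectories `(x₀, a₀, x₁, a₁, …)`. -/
noncomputable def pathMeasure (M : MDP X A) (π : M.Policy) (x : X) : Measure (ℕ → X × A) :=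
  Kernel.trajMeasure (X := fun _ => X × A) (M.initialLaw π x) (M.stepKernel π)

/-- Expected total cost `v_N^π(x)` over the horizon `N`. -/
noncomputable def horizonCost (M : MDP X A) (π : M.Policy) (N : ℕ) (x : X) : EReal :=
  extIntegral (M.pathMeasure π x) fun ω => ∑ n ∈ Finset.range N, M.cost (ω n)

/-- Expected total discounted cost `v_α^π(x)` over the infinite horizon, for `α ∈ [0, 1)`. -/
noncomputable def discCost (M : MDP X A) (π : M.Policy) (α : ℝ) (x : X) : EReal :=
  extIntegral (M.pathMeasure π x) fun ω => extSum fun n => ((α ^ n : ℝ) : EReal) * M.cost (ω n)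

/-- Average cost per unit time `w^π(x)`. -/
noncomputable def avgCost (M : MDP X A) (π : M.Policy) (x : X) : EReal :=
  limsup (fun N : ℕ => (((N : ℝ)⁻¹ : ℝ) : EReal) * M.horizonCost π N x) atTop

/-- Optimal discounted cost `v_α(x)`. -/
noncomputable def discValue (M : MDP X A) (α : ℝ) (x : X) : EReal :=
  ⨅ π : M.Policy, M.discCost π α x

/-- Optimal average cost `w(x)`. -/
noncomputable def avgValue (M : MDP X A) (x : X) : EReal :=
  ⨅ π : M.Policy, M.avgCost π x

/-- The policy `π` is average-cost optimal. -/
def IsAvgOptimal (M : MDP X A) (π : M.Policy) : Prop :=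
  ∀ x, M.avgCost π x = M.avgValue x

/-- `w^* = inf_x w(x)`. -/
noncomputable def wStar (M : MDP X A) : EReal := ⨅ x, M.avgValue x

/-- `m_α = inf_x v_α(x)`. -/
noncomputable def minDisc (M : MDP X A) (α : ℝ) : EReal := ⨅ x, M.discValue α x

/-- `u_α(x) = v_α(x) - m_α`. -/
noncomputable def relDisc (M : MDP X A) (α : ℝ) (x : X) : EReal :=
  M.discValue α x - M.minDisc α

/-- The upper limit of `(1 - α) m_α` as `α ↑ 1`. -/
noncomputable def wBar (M : MDP X A) : EReal :=
  limsup (fun α : ℝ => ((1 - α : ℝ) : EReal) * M.minDisc α) (𝓝[<] 1)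

/-- `c(x, a) + ∫ f dq(· | x, a)`. -/
noncomputable def oneStep (M : MDP X A) (f : X → EReal) (x : X) (a : A) : EReal :=
  M.cost (x, a) + extIntegral (M.trans (x, a)) f

/-- The set of actions `a ∈ A(x)` with `w̄ + f(x) ≥ c(x, a) + ∫ f dq(· | x, a)`. -/
def acoiActions (M : MDP X A) (f : X → EReal) (x : X) : Set A :=
  {a | a ∈ M.actions x ∧ M.oneStep f x a ≤ M.wBar + f x}

/-- The set of actions that minimize `c(x, a) + ∫ f dq(· | x, a)` over `A(x)`. -/
def minActions (M : MDP X A) (f : X → EReal) (x : X) : Set A :=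
  {a | a ∈ M.actions x ∧ (⨅ b ∈ M.actions x, M.oneStep f x b) = M.oneStep f x a}

/-- The Assumption (`B` underlined): `w^* < ∞`, and the lower limit of `u_α(x)` as `α ↑ 1` is
finite for every `x`. -/
structure AssumptionB (M : MDP X A) : Prop where
  general : M.wStar < ⊤
  liminf_lt : ∀ x, liminf (fun α : ℝ => M.relDisc α x) (𝓝[<] 1) < ⊤

variable [TopologicalSpace X] [TopologicalSpace A]

/-- `u(x)`, the lower limit of `u_α(y)` as `α ↑ 1` and `y → x`. -/
noncomputable def relLimit (M : MDP X A) (x : X) : EReal :=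
  liminf (fun p : ℝ × X => M.relDisc p.1 p.2) (𝓝[<] (1 : ℝ) ×ˢ 𝓝 x)

/-- The transition probabilities are weakly continuous on the graph. -/
def WeaklyContinuous (M : MDP X A) : Prop :=
  ∀ f : X →ᵇ ℝ, ContinuousOn (fun p => ∫ z, f z ∂(M.trans p)) M.graph

/-- Assumption (W*). -/
structure AssumptionWStar (M : MDP X A) : Prop where
  lsc_cost : LowerSemicontinuousOn M.cost M.graph
  bddBelow : ∃ K : ℝ, ∀ p ∈ M.graph, (K : EReal) ≤ M.cost p
  limit_point : ∀ (x : ℕ → X) (x₀ : X), Tendsto x atTop (𝓝 x₀) →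
    ∀ a : ℕ → A, (∀ n, a n ∈ M.actions (x n)) →
      (∃ C : ℝ, ∀ n, M.cost (x n, a n) ≤ (C : EReal)) →
      ∃ a₀ ∈ M.actions x₀, MapClusterPt a₀ atTop a
  weak : M.WeaklyContinuous

/-- Assumption (Wu). -/
structure AssumptionWu (M : MDP X A) : Prop where
  infCompact_cost : InfCompactOn M.cost M.graph
  weak : M.WeaklyContinuous

end MDP

/-!
Adding a constant `L` to the cost makes it nonnegative and shifts every average cost by `L` and
every `α`-discounted cost by `L / (1 - α)`, so the argument takes place in `[0, ∞]`.

Conditioning a nearly optimal `α`-discounted policy at `y` on its first step gives an action `a`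
with `c(y, a) + α ∫ u_α dq(· | y, a) ≤ u_α(y) + (1 - α) m_α + ε`. Let `α ↑ 1` and `y → x` so that
`u_α(y)` tends to `u(x)`: by (W*)(ii) the actions have a limit point in `A(x)`, and Fatou's lemma
for weakly converging measures bounds its one-step cost by `w̄ + u(x) + ε`. Since the one-step
cost is inf-compact in the action, this yields the optimality inequality (1), and its minimizers
admit a measurable selection.

Iterating (1) along a stationary policy `φ` gives `v_N^φ ≤ N w̄ + u`, hence `w^φ ≤ w̄`. Conversely,
the Abel means `(1 - α) v_α^π` are asymptotically at most the upper Cesàro limit `w^π`, so `w̄` is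
at most `w^π` for every policy `π`. Together the two bounds give (2).
-/

section ExtendedIntegral

variable {Ω : Type*} [MeasurableSpace Ω] {μ : Measure Ω}

theorem extIntegral_congr_ae {f g : Ω → EReal} (h : f =ᵐ[μ] g) :
    extIntegral μ f = extIntegral μ g := by
  have hpos : (fun ω => (f ω).toENNReal) =ᵐ[μ] fun ω => (g ω).toENNReal :=
    h.fun_comp EReal.toENNReal
  have hneg : (fun ω => (-f ω).toENNReal) =ᵐ[μ] fun ω => (-g ω).toENNReal :=
    h.fun_comp fun e => (-e).toENNReal
  rw [extIntegral, extIntegral, lintegral_congr_ae hpos, lintegral_congr_ae hneg]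

theorem extIntegral_coe (g : Ω → ℝ≥0∞) :
    extIntegral μ (fun ω => (g ω : EReal)) = ((∫⁻ ω, g ω ∂μ : ℝ≥0∞) : EReal) := by
  have hneg : ∀ ω, (-(g ω : EReal)).toENNReal = 0 := fun ω =>
    EReal.toENNReal_of_nonpos (by simpa using EReal.coe_ennreal_nonneg _)
  simp only [extIntegral, hneg, EReal.toENNReal_coe, lintegral_zero, EReal.coe_ennreal_zero,
    sub_zero]

theorem coe_sub_coe_eq_of_add_eq_add {a b c d : ℝ≥0∞} (hb : b ≠ ⊤) (hd : d ≠ ⊤)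
    (h : a + d = b + c) : (a : EReal) - b = c - d := by
  lift b to NNReal using hb
  lift d to NNReal using hd
  have h' : (a : EReal) + (d : ℝ) = c + (b : ℝ) := by
    have hcoe := congrArg (fun e : ℝ≥0∞ => (e : EReal)) h
    simpa only [EReal.coe_ennreal_add, EReal.coe_nnreal_eq_coe_real, add_comm] using hcoe
  calc (a : EReal) - (b : ℝ) = a + (d : ℝ) - (d : ℝ) - (b : ℝ) := by
        rw [EReal.add_sub_cancel_right]
    _ = c + (b : ℝ) - (b : ℝ) - (d : ℝ) := by
        rw [h', sub_eq_add_neg, sub_eq_add_neg, sub_eq_add_neg, sub_eq_add_neg, add_right_comm]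
    _ = c - (d : ℝ) := by rw [EReal.add_sub_cancel_right]

theorem extIntegral_coe_sub_coe {g h : Ω → ℝ≥0∞} (hg : Measurable g) (hh : Measurable h)
    (hfin : ∀ ω, h ω ≠ ⊤) (hint : ∫⁻ ω, h ω ∂μ ≠ ⊤) :
    extIntegral μ (fun ω => (g ω : EReal) - (h ω : EReal))
      = ((∫⁻ ω, g ω ∂μ : ℝ≥0∞) : EReal) - ((∫⁻ ω, h ω ∂μ : ℝ≥0∞) : EReal) := by
  have hpos : ∀ ω, ((g ω : EReal) - (h ω : EReal)).toENNReal = g ω - h ω := fun ω => by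
    simp [EReal.toENNReal_sub (EReal.coe_ennreal_nonneg _)]
  have hneg : ∀ ω, (-((g ω : EReal) - (h ω : EReal))).toENNReal = h ω - g ω := fun ω => by
    rw [EReal.neg_sub (Or.inr (by simp)) (Or.inr (by simpa using hfin ω)),
      add_comm, ← sub_eq_add_neg, EReal.toENNReal_sub (EReal.coe_ennreal_nonneg _)]
    simp
  have hle : ∫⁻ ω, (h ω - g ω) ∂μ ≤ ∫⁻ ω, h ω ∂μ := lintegral_mono fun ω => tsub_le_self
  rw [extIntegral, lintegral_congr hpos, lintegral_congr hneg]
  refine coe_sub_coe_eq_of_add_eq_add (ne_top_of_le_ne_top hint hle) hint ?_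
  rw [← lintegral_add_right _ hh, ← lintegral_add_right _ hg]
  exact lintegral_congr fun ω => by rw [tsub_add_eq_max, tsub_add_eq_max, max_comm]

theorem extSum_eq_extIntegral_count (f : ℕ → EReal) : extSum f = extIntegral Measure.count f := by
  simp [extSum, extIntegral, lintegral_count]

theorem liminf_add_liminf_le_liminf_add {ι : Type*} {l : Filter ι} (f g : ι → ℝ≥0∞) :
    liminf f l + liminf g l ≤ liminf (fun i => f i + g i) l := by
  simp only [l.basis_sets.liminf_eq_iSup_iInf, id]
  refine ENNReal.biSup_add_biSup_le' ⟨_, univ_mem⟩ ⟨_, univ_mem⟩ fun s hs t ht => ?_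
  refine le_iSup₂_of_le (s ∩ t) (inter_mem hs ht) (le_iInf₂ fun i hi => ?_)
  exact add_le_add (iInf₂_le i hi.1) (iInf₂_le i hi.2)

end ExtendedIntegral

section AbelCesaro

variable {r : ℝ≥0∞}

theorem one_sub_mul_inv_one_sub (hr : r < 1) : (1 - r) * (1 - r)⁻¹ = 1 :=
  ENNReal.mul_inv_cancel (tsub_pos_of_lt hr).ne' (ENNReal.sub_ne_top ENNReal.one_ne_top)

theorem tsum_ite_le_pow (r : ℝ≥0∞) (n : ℕ) :
    ∑' m, (if n ≤ m then r ^ m else 0) = r ^ n * (1 - r)⁻¹ := by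
  rw [← ENNReal.summable.sum_add_tsum_nat_add' (k := n),
    Finset.sum_eq_zero fun m hm => if_neg (by simpa using hm), zero_add,
    ← ENNReal.tsum_geometric, ← ENNReal.tsum_mul_left]
  exact tsum_congr fun m => by rw [if_pos (Nat.le_add_left _ _), pow_add, mul_comm]

theorem tsum_pow_mul_sum_range_succ (r : ℝ≥0∞) (a : ℕ → ℝ≥0∞) :
    ∑' m, r ^ m * ∑ n ∈ Finset.range (m + 1), a n = (1 - r)⁻¹ * ∑' n, r ^ n * a n := by
  have hsum : ∀ m, r ^ m * ∑ n ∈ Finset.range (m + 1), a n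
      = ∑' n, (if n ≤ m then r ^ m else 0) * a n := fun m => by
    rw [tsum_eq_sum (s := Finset.range (m + 1)) fun n hn => by
      rw [if_neg (by simpa using hn), zero_mul], Finset.mul_sum]
    exact Finset.sum_congr rfl fun n hn => by
      rw [if_pos (Nat.lt_succ_iff.1 (Finset.mem_range.1 hn))]
  simp_rw [hsum]
  rw [ENNReal.tsum_comm, ← ENNReal.tsum_mul_left]
  refine tsum_congr fun n => ?_
  rw [ENNReal.tsum_mul_right, tsum_ite_le_pow]
  ring

theorem one_sub_mul_tsum_pow_mul_le_of_sum_range_le (hr : r < 1) {a : ℕ → ℝ≥0∞} {C b : ℝ≥0∞}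
    (h : ∀ N, ∑ n ∈ Finset.range N, a n ≤ C + N * b) :
    (1 - r) * ∑' n, r ^ n * a n ≤ (1 - r) * C + b := by
  have hcancel := one_sub_mul_inv_one_sub hr
  have habel : ∀ a : ℕ → ℝ≥0∞, ∑' n, r ^ n * a n
      = (1 - r) * ∑' m, r ^ m * ∑ n ∈ Finset.range (m + 1), a n := fun a => by
    rw [tsum_pow_mul_sum_range_succ, ← mul_assoc, hcancel, one_mul]
  have hgeom : (1 - r) * ∑' m, r ^ m * ((m + 1 : ℕ) : ℝ≥0∞) = (1 - r)⁻¹ := by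
    simpa [ENNReal.tsum_geometric] using (habel fun _ => 1).symm
  calc (1 - r) * ∑' n, r ^ n * a n
      = (1 - r) * ((1 - r) * ∑' m, r ^ m * ∑ n ∈ Finset.range (m + 1), a n) := by rw [habel a]
    _ ≤ (1 - r) * ((1 - r) * ∑' m, r ^ m * (C + ((m + 1 : ℕ) : ℝ≥0∞) * b)) := by
        gcongr with m; exact h _
    _ = (1 - r) * ((1 - r) * (1 - r)⁻¹ * C
          + ((1 - r) * ∑' m, r ^ m * ((m + 1 : ℕ) : ℝ≥0∞)) * b) := by
        simp_rw [mul_add, ← mul_assoc]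
        rw [ENNReal.tsum_add, ENNReal.tsum_mul_right, ENNReal.tsum_mul_right,
          ENNReal.tsum_geometric]
        ring
    _ = (1 - r) * C + b := by
        rw [hgeom, hcancel, one_mul, mul_add, ← mul_assoc, hcancel, one_mul]

theorem exists_sum_range_le_add_mul_of_limsup_lt {a : ℕ → ℝ≥0∞} {b : ℝ≥0∞}
    (h : limsup (fun N : ℕ => (N : ℝ≥0∞)⁻¹ * ∑ n ∈ Finset.range N, a n) atTop < b)
    (hb : b ≠ ⊤) :
    ∃ C : ℝ≥0∞, C ≠ ⊤ ∧ ∀ N, ∑ n ∈ Finset.range N, a n ≤ C + N * b := by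
  obtain ⟨N₀, hN₀⟩ := eventually_atTop.1 (eventually_lt_of_limsup_lt h)
  have hlarge : ∀ N ≥ N₀ + 1, ∑ n ∈ Finset.range N, a n ≤ N * b := fun N hN => by
    rw [mul_comm, ← ENNReal.div_le_iff (Nat.cast_ne_zero.2 (by lia)) (ENNReal.natCast_ne_top N),
      ENNReal.div_eq_inv_mul]
    exact (hN₀ N (by lia)).le
  refine ⟨∑ n ∈ Finset.range (N₀ + 1), a n, ?_, fun N => ?_⟩
  · exact ne_top_of_le_ne_top (ENNReal.mul_ne_top (ENNReal.natCast_ne_top _) hb) (hlarge _ le_rfl)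
  · rcases le_total N (N₀ + 1) with hsmall | hN
    · exact (Finset.sum_le_sum_of_subset (Finset.range_mono hsmall)).trans le_self_add
    · exact (hlarge N hN).trans le_add_self

theorem limsup_abel_mean_le_limsup_cesaro_mean (a : ℕ → ℝ≥0∞) :
    limsup (fun r : ℝ≥0∞ => (1 - r) * ∑' n, r ^ n * a n) (𝓝[<] 1)
      ≤ limsup (fun N : ℕ => (N : ℝ≥0∞)⁻¹ * ∑ n ∈ Finset.range N, a n) atTop := by
  refine le_of_forall_gt_imp_ge_of_dense fun b hb => ?_
  rcases eq_or_ne b ⊤ with rfl | hb_top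
  · exact le_top
  obtain ⟨C, hC, hsum⟩ := exists_sum_range_le_add_mul_of_limsup_lt hb hb_top
  have hlim : Tendsto (fun r : ℝ≥0∞ => (1 - r) * C + b) (𝓝[<] 1) (𝓝 b) := by
    have hsub : Tendsto (fun r : ℝ≥0∞ => 1 - r) (𝓝[<] 1) (𝓝 0) := by
      simpa using (ENNReal.continuous_sub_left ENNReal.one_ne_top).continuousWithinAt
        (s := Set.Iio 1) (x := 1) |>.tendsto
    simpa using (ENNReal.Tendsto.mul_const hsub (Or.inr hC)).add_const b
  have : (𝓝[<] (1 : ℝ≥0∞)).NeBot := nhdsLT_neBot_of_exists_lt ⟨0, one_pos⟩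
  rw [← hlim.limsup_eq]
  exact limsup_le_limsup <| eventually_mem_nhdsWithin.mono fun r hr =>
    one_sub_mul_tsum_pow_mul_le_of_sum_range_le hr hsum

end AbelCesaro

section Fatou

theorem lowerSemicontinuous_liminf_prod_nhds {ι S γ : Type*} [TopologicalSpace S]
    [CompleteLinearOrder γ] [DenselyOrdered γ] (l : Filter ι) (f : ι × S → γ) :
    LowerSemicontinuous fun x => liminf f (l ×ˢ 𝓝 x) := by
  intro x b hb
  obtain ⟨c, hbc, hc⟩ := exists_between hb
  obtain ⟨s, hs, t, ht, hst⟩ := mem_prod_iff.1 (eventually_lt_of_lt_liminf hc)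
  filter_upwards [eventually_mem_nhds_iff.2 ht] with y hy
  refine hbc.trans_le (le_liminf_of_le (by isBoundedDefault) ?_)
  filter_upwards [prod_mem_prod hs hy] with p hp
  exact (hst hp).le

theorem liminf_principal_prod_nhds_le {ι S γ : Type*} [TopologicalSpace S] [CompleteLattice γ]
    (f : ι × S → γ) {s : Set ι} {i : ι} (hi : i ∈ s) (y : S) :
    liminf f (𝓟 s ×ˢ 𝓝 y) ≤ f (i, y) := by
  refine sSup_le fun b hb => ?_
  obtain ⟨t, ht, v, hv, htv⟩ := mem_prod_iff.1 (eventually_map.1 hb)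
  exact htv (Set.mk_mem_prod (mem_principal.1 ht hi) (mem_of_mem_nhds hv))

theorem liminf_atTop_prod_le_iSup {ι S γ : Type*} [Preorder ι] [IsDirectedOrder ι] [Nonempty ι]
    [CompleteLinearOrder γ] [DenselyOrdered γ] (f : ι × S → γ) (l : Filter S) :
    liminf f (atTop ×ˢ l) ≤ ⨆ k, liminf f (𝓟 (Set.Ici k) ×ˢ l) := by
  refine le_of_forall_lt_imp_le_of_dense fun b hb => ?_
  obtain ⟨s, hs, t, ht, hst⟩ := mem_prod_iff.1 (eventually_lt_of_lt_liminf hb)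
  obtain ⟨k, hk⟩ := mem_atTop_sets.1 hs
  refine le_iSup_of_le k (le_liminf_of_le (by isBoundedDefault) ?_)
  filter_upwards [prod_mem_prod (mem_principal_self (Set.Ici k)) ht] with p hp
  exact le_of_lt (hst (Set.mk_mem_prod (hk _ hp.1) hp.2))

variable {S : Type*} [MeasurableSpace S] [TopologicalSpace S] [OpensMeasurableSpace S]
  {μ : Measure S} {μs : ℕ → Measure S}

theorem lintegral_ofReal_le_liminf_of_forall_isOpen
    (h : ∀ G, IsOpen G → μ G ≤ liminf (fun i => μs i G) atTop)
    {f : S → ℝ} (hf₀ : 0 ≤ f) (hf : LowerSemicontinuous f) :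
    ∫⁻ x, ENNReal.ofReal (f x) ∂μ
      ≤ liminf (fun i => ∫⁻ x, ENNReal.ofReal (f x) ∂(μs i)) atTop := by
  have layercake : ∀ ν : Measure S, ∫⁻ x, ENNReal.ofReal (f x) ∂ν
      = ∫⁻ t in Set.Ioi (0 : ℝ), ν {x | t < f x} := fun ν =>
    lintegral_eq_lintegral_meas_lt ν (Eventually.of_forall hf₀) hf.measurable.aemeasurable
  simp_rw [layercake]
  calc ∫⁻ t in Set.Ioi (0 : ℝ), μ {x | t < f x}
      ≤ ∫⁻ t in Set.Ioi (0 : ℝ), liminf (fun i => μs i {x | t < f x}) atTop :=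
        lintegral_mono fun t => h _ (hf.isOpen_preimage t)
    _ ≤ _ := lintegral_liminf_le fun n => Antitone.measurable fun s t hst =>
        measure_mono fun x hx => lt_of_le_of_lt hst hx

theorem lintegral_le_liminf_of_forall_isOpen
    (h : ∀ G, IsOpen G → μ G ≤ liminf (fun i => μs i G) atTop)
    {f : S → ℝ≥0∞} (hf : LowerSemicontinuous f) :
    ∫⁻ x, f x ∂μ ≤ liminf (fun i => ∫⁻ x, f x ∂(μs i)) atTop := by
  have hmin_ofReal : ∀ (k : ℕ) x,
      min (k : ℝ≥0∞) (f x) = ENNReal.ofReal (ENNReal.truncateToReal k (f x)) := fun k x =>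
    (ENNReal.ofReal_toReal (ne_top_of_le_ne_top (ENNReal.natCast_ne_top k) (min_le_left _ _))).symm
  have htrunc : ∀ k : ℕ, ∫⁻ x, min (k : ℝ≥0∞) (f x) ∂μ
      ≤ liminf (fun i => ∫⁻ x, min (k : ℝ≥0∞) (f x) ∂(μs i)) atTop := fun k => by
    simp_rw [hmin_ofReal]
    exact lintegral_ofReal_le_liminf_of_forall_isOpen h (fun x => ENNReal.toReal_nonneg)
      ((ENNReal.continuous_truncateToReal (ENNReal.natCast_ne_top k)).comp_lowerSemicontinuous hf
        (ENNReal.monotone_truncateToReal (ENNReal.natCast_ne_top k)))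
  have hsup : ∀ x, f x = ⨆ k : ℕ, min (k : ℝ≥0∞) (f x) := fun x => by
    rw [← iSup_inf_eq, ENNReal.iSup_natCast, top_inf_eq]
  have hmono : Monotone fun (k : ℕ) x => min (k : ℝ≥0∞) (f x) := fun i j hij x =>
    min_le_min_right _ (by exact_mod_cast hij)
  calc ∫⁻ x, f x ∂μ = ∫⁻ x, ⨆ k : ℕ, min (k : ℝ≥0∞) (f x) ∂μ := lintegral_congr hsup
    _ = ⨆ k : ℕ, ∫⁻ x, min (k : ℝ≥0∞) (f x) ∂μ :=
        lintegral_iSup (fun k => measurable_const.min hf.measurable) hmono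
    _ ≤ _ := iSup_le fun k => (htrunc k).trans
        (liminf_le_liminf (Eventually.of_forall fun i => lintegral_mono fun x => min_le_right _ _))

theorem le_liminf_isOpen_of_tendsto_integral [HasOuterApproxClosed S] [hμ : IsProbabilityMeasure μ]
    [hμs : ∀ n, IsProbabilityMeasure (μs n)]
    (h : ∀ f : S →ᵇ ℝ, Tendsto (fun n => ∫ z, f z ∂(μs n)) atTop (𝓝 (∫ z, f z ∂μ)))
    {G : Set S} (hG : IsOpen G) : μ G ≤ liminf (fun i => μs i G) atTop := by
  let P : ProbabilityMeasure S := ⟨μ, hμ⟩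
  let Ps : ℕ → ProbabilityMeasure S := fun n => ⟨μs n, hμs n⟩
  have hP : Tendsto Ps atTop (𝓝 P) := ProbabilityMeasure.tendsto_iff_forall_integral_tendsto.2 h
  exact ProbabilityMeasure.le_liminf_measure_open_of_tendsto hP hG

/-- The integrands `f n` need not be measurable: the lower envelopes through which they enter are
lower semicontinuous. -/
theorem lintegral_le_liminf_of_tendsto_integral [HasOuterApproxClosed S] [IsProbabilityMeasure μ]
    [∀ n, IsProbabilityMeasure (μs n)]
    (h : ∀ f : S →ᵇ ℝ, Tendsto (fun n => ∫ z, f z ∂(μs n)) atTop (𝓝 (∫ z, f z ∂μ)))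
    {f : ℕ → S → ℝ≥0∞} {g : S → ℝ≥0∞}
    (hg : ∀ y, g y ≤ liminf (fun p : ℕ × S => f p.1 p.2) (atTop ×ˢ 𝓝 y)) :
    ∫⁻ y, g y ∂μ ≤ liminf (fun n => ∫⁻ y, f n y ∂(μs n)) atTop := by
  let env : ℕ → S → ℝ≥0∞ := fun k y =>
    liminf (fun p : ℕ × S => f p.1 p.2) (𝓟 (Set.Ici k) ×ˢ 𝓝 y)
  have henv_lsc : ∀ k, LowerSemicontinuous (env k) := fun k =>
    lowerSemicontinuous_liminf_prod_nhds _ _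
  have henv_mono : Monotone env := fun i j hij y =>
    liminf_le_liminf_of_le (prod_mono_left _ (principal_mono.2 (Set.Ici_subset_Ici.2 hij)))
  have henv_le : ∀ k n, k ≤ n → ∀ y, env k y ≤ f n y := fun k n hkn y =>
    liminf_principal_prod_nhds_le (fun p : ℕ × S => f p.1 p.2) (Set.mem_Ici.2 hkn) y
  calc ∫⁻ y, g y ∂μ
      ≤ ∫⁻ y, ⨆ k, env k y ∂μ :=
        lintegral_mono fun y => (hg y).trans (liminf_atTop_prod_le_iSup _ _)
    _ = ⨆ k, ∫⁻ y, env k y ∂μ := lintegral_iSup (fun k => (henv_lsc k).measurable) henv_mono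
    _ ≤ _ := iSup_le fun k =>
        (lintegral_le_liminf_of_forall_isOpen
          (fun _ => le_liminf_isOpen_of_tendsto_integral h) (henv_lsc k)).trans <|
        liminf_le_liminf ((eventually_ge_atTop k).mono fun n hn => lintegral_mono (henv_le k n hn))

end Fatou

section MeasurableSelection

/-- A multifunction with nonempty compact values for which the preimages of closed sets are
measurable. -/
structure IsMeasurableCompactMap {S Y : Type*} [MeasurableSpace S] [TopologicalSpace Y]
    (Γ : S → Set Y) : Prop where
  isCompact : ∀ s, IsCompact (Γ s)
  nonempty : ∀ s, (Γ s).Nonempty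
  measurableSet : ∀ F : Set Y, IsClosed F → MeasurableSet {s | (Γ s ∩ F).Nonempty}

namespace IsMeasurableCompactMap

variable {S Y : Type*} [MeasurableSpace S]

theorem inter_piecewise [TopologicalSpace Y] {Γ : S → Set Y}
    (hΓ : IsMeasurableCompactMap Γ) {B : ℕ → Set Y} (hB : ∀ j, IsClosed (B j)) {j : S → ℕ}
    (hj : Measurable j) (hne : ∀ s, (Γ s ∩ B (j s)).Nonempty) :
    IsMeasurableCompactMap fun s => Γ s ∩ B (j s) where
  isCompact s := (hΓ.isCompact s).inter_right (hB _)
  nonempty := hne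
  measurableSet F hF := by
    have hunion : {s | (Γ s ∩ B (j s) ∩ F).Nonempty}
        = ⋃ i, j ⁻¹' {i} ∩ {s | (Γ s ∩ (B i ∩ F)).Nonempty} := by
      ext s
      simp [Set.inter_assoc]
    rw [hunion]
    exact MeasurableSet.iUnion fun i => (hj (measurableSet_singleton i)).inter
      (hΓ.measurableSet _ ((hB i).inter hF))

theorem exists_subset_closedBall [MetricSpace Y] [SecondCountableTopology Y] {Γ : S → Set Y}
    (hΓ : IsMeasurableCompactMap Γ) {r : ℝ} (hr : 0 < r) :
    ∃ Γ' : S → Set Y, IsMeasurableCompactMap Γ' ∧ (∀ s, Γ' s ⊆ Γ s) ∧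
      ∀ s, ∃ y, Γ' s ⊆ Metric.closedBall y r := by
  classical
  rcases isEmpty_or_nonempty S with _ | ⟨⟨s₀⟩⟩
  · exact ⟨Γ, hΓ, fun s => subset_rfl, isEmptyElim⟩
  have : Nonempty Y := (hΓ.nonempty s₀).nonempty
  let d := TopologicalSpace.denseSeq Y
  have hex : ∀ s, ∃ j, (Γ s ∩ Metric.closedBall (d j) r).Nonempty := fun s => by
    obtain ⟨y, hy⟩ := hΓ.nonempty s
    obtain ⟨j, hj⟩ := (TopologicalSpace.denseRange_denseSeq Y).exists_dist_lt y hr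
    exact ⟨j, y, hy, hj.le⟩
  have hfind : Measurable fun s => Nat.find (hex s) :=
    measurable_find hex fun j => hΓ.measurableSet _ Metric.isClosed_closedBall
  exact ⟨fun s => Γ s ∩ Metric.closedBall (d (Nat.find (hex s))) r,
    hΓ.inter_piecewise (fun _ => Metric.isClosed_closedBall) hfind fun s => Nat.find_spec (hex s),
    fun s => Set.inter_subset_left, fun s => ⟨_, Set.inter_subset_right⟩⟩

theorem exists_seq_subset_closedBall [MetricSpace Y] [SecondCountableTopology Y] {Γ : S → Set Y}
    (hΓ : IsMeasurableCompactMap Γ) :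
    ∃ Δ : ℕ → S → Set Y, Δ 0 = Γ ∧ (∀ k, IsMeasurableCompactMap (Δ k)) ∧
      (∀ k s, Δ (k + 1) s ⊆ Δ k s) ∧
      ∀ k s, ∃ y, Δ (k + 1) s ⊆ Metric.closedBall y ((1 / 2) ^ k) := by
  have hrefine : ∀ (k : ℕ) (Δ : {Δ : S → Set Y // IsMeasurableCompactMap Δ}),
      ∃ Δ' : {Δ : S → Set Y // IsMeasurableCompactMap Δ}, (∀ s, Δ'.1 s ⊆ Δ.1 s) ∧
        ∀ s, ∃ y, Δ'.1 s ⊆ Metric.closedBall y ((1 / 2) ^ k) := fun k Δ => by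
    obtain ⟨Δ', hΔ', hsub, hball⟩ := Δ.2.exists_subset_closedBall (r := (1 / 2) ^ k) (by positivity)
    exact ⟨⟨Δ', hΔ'⟩, hsub, hball⟩
  choose next hsub hball using hrefine
  let Δ : ℕ → {Δ : S → Set Y // IsMeasurableCompactMap Δ} := fun n => Nat.rec ⟨Γ, hΓ⟩ next n
  exact ⟨fun k => (Δ k).1, rfl, fun k => (Δ k).2, fun k => hsub k (Δ k), fun k => hball k (Δ k)⟩

/-- The Kuratowski–Ryll-Nardzewski selection theorem for compact-valued multifunctions. -/
theorem exists_measurable_selector [TopologicalSpace Y] [TopologicalSpace.MetrizableSpace Y]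
    [SecondCountableTopology Y] [MeasurableSpace Y] [BorelSpace Y] {Γ : S → Set Y}
    (hΓ : IsMeasurableCompactMap Γ) :
    ∃ f : S → Y, Measurable f ∧ ∀ s, f s ∈ Γ s := by
  let := TopologicalSpace.metrizableSpaceMetric Y
  obtain ⟨Δ, hΔ₀, hΔ, hsub, hball⟩ := hΓ.exists_seq_subset_closedBall
  have hinter : ∀ s, ∀ F : Set Y, IsClosed F → (∀ k, (Δ k s ∩ F).Nonempty) →
      (⋂ k, Δ k s ∩ F).Nonempty := fun s F hF hne =>
    IsCompact.nonempty_iInter_of_sequence_nonempty_isCompact_isClosed _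
      (fun k => Set.inter_subset_inter_left _ (hsub k s)) hne
      (((hΔ 0).isCompact s).inter_right hF) fun k => ((hΔ k).isCompact s).isClosed.inter hF
  have hex : ∀ s, ∃ y, ∀ k, y ∈ Δ k s := fun s => by
    obtain ⟨y, hy⟩ := hinter s Set.univ isClosed_univ fun k => by
      simpa using (hΔ k).nonempty s
    exact ⟨y, fun k => (Set.mem_iInter.1 hy k).1⟩
  have hunique : ∀ s y z, (∀ k, y ∈ Δ k s) → (∀ k, z ∈ Δ k s) → y = z := fun s y z hy hz => by
    have hlim : Tendsto (fun k : ℕ => ((1 : ℝ) / 2) ^ k + (1 / 2) ^ k) atTop (𝓝 (0 + 0)) :=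
      have := tendsto_pow_atTop_nhds_zero_of_lt_one (r := (1 : ℝ) / 2) (by norm_num) (by norm_num)
      this.add this
    have hle : dist y z ≤ 0 + 0 := ge_of_tendsto' hlim fun k => by
      obtain ⟨c, hc⟩ := hball k s
      exact (dist_triangle_right y z c).trans (add_le_add (hc (hy _)) (hc (hz _)))
    exact dist_le_zero.1 (by simpa using hle)
  choose f hf using hex
  refine ⟨f, measurable_of_isClosed fun F hF => ?_, fun s => hΔ₀ ▸ hf s 0⟩
  have hpreimage : f ⁻¹' F = ⋂ k, {s | (Δ k s ∩ F).Nonempty} := by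
    ext s
    simp only [Set.mem_preimage, Set.mem_iInter, Set.mem_ofPred_eq]
    refine ⟨fun h k => ⟨f s, hf s k, h⟩, fun h => ?_⟩
    obtain ⟨y, hy⟩ := hinter s F hF h
    have hyΔ := fun k => Set.mem_iInter.1 hy k
    exact hunique s (f s) y (hf s) (fun k => (hyΔ k).1) ▸ (hyΔ 0).2
  rw [hpreimage]
  exact MeasurableSet.iInter fun k => (hΔ k).measurableSet F hF

end IsMeasurableCompactMap

end MeasurableSelection

section KInfCompact

/-- K-inf-compactness of `h` on the graph of `D`, which amounts to joint lower semicontinuity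
together with inf-compactness in the second variable, locally uniformly in the first one. It is
stated through sequences, as in Assumption (W*). -/
def KInfCompact {S Y : Type*} [TopologicalSpace S] [TopologicalSpace Y] (D : S → Set Y)
    (h : S × Y → ℝ≥0∞) : Prop :=
  ∀ ⦃x : ℕ → S⦄ ⦃x₀ : S⦄, Tendsto x atTop (𝓝 x₀) → ∀ ⦃a : ℕ → Y⦄, (∀ n, a n ∈ D (x n)) →
    ∀ ⦃C : ℝ≥0∞⦄, C ≠ ⊤ → (∀ n, h (x n, a n) ≤ C) →
      ∃ a₀ ∈ D x₀, MapClusterPt a₀ atTop a ∧ h (x₀, a₀) ≤ C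

namespace KInfCompact

variable {S Y : Type*} [TopologicalSpace S] [TopologicalSpace Y] {D : S → Set Y}
  {h : S × Y → ℝ≥0∞}

theorem le_liminf [T2Space Y] (H : KInfCompact D h) {x : ℕ → S} {x₀ : S}
    (hx : Tendsto x atTop (𝓝 x₀)) {a : ℕ → Y} {a₀ : Y} (ha : Tendsto a atTop (𝓝 a₀))
    (haD : ∀ n, a n ∈ D (x n)) : h (x₀, a₀) ≤ liminf (fun n => h (x n, a n)) atTop := by
  refine le_of_forall_gt_imp_ge_of_dense fun C hC => ?_
  rcases eq_or_ne C ⊤ with rfl | hC_top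
  · exact le_top
  obtain ⟨ψ, hψ, hle⟩ := extraction_of_frequently_atTop
    (frequently_lt_of_liminf_lt (by isBoundedDefault) hC)
  obtain ⟨a₁, -, hcluster, hle₁⟩ := H (hx.comp hψ.tendsto_atTop) (fun n => haD (ψ n)) hC_top
    fun n => (hle n).le
  have : (𝓝 a₁ ⊓ 𝓝 a₀).NeBot := hcluster.clusterPt.mono (ha.comp hψ.tendsto_atTop)
  rwa [eq_of_nhds_neBot this] at hle₁

theorem inter (H : KInfCompact D h) {F : Set Y} (hF : IsClosed F) :
    KInfCompact (fun x => D x ∩ F) h := by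
  intro x x₀ hx a ha C hC hle
  obtain ⟨a₀, ha₀, hcluster, hle₀⟩ := H hx (fun n => (ha n).1) hC hle
  exact ⟨a₀, ⟨ha₀, hF.mem_of_mapClusterPt hcluster (Eventually.of_forall fun n => (ha n).2)⟩,
    hcluster, hle₀⟩

variable [TopologicalSpace.MetrizableSpace Y]

theorem isCompact_setOf_le (H : KInfCompact D h) (x : S) {C : ℝ≥0∞} (hC : C ≠ ⊤) :
    IsCompact {a | a ∈ D x ∧ h (x, a) ≤ C} := by
  let := TopologicalSpace.metrizableSpaceMetric Y
  refine IsSeqCompact.isCompact fun a ha => ?_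
  obtain ⟨a₀, ha₀, hcluster, hle⟩ := H tendsto_const_nhds (fun n => (ha n).1) hC fun n => (ha n).2
  exact ⟨a₀, ⟨ha₀, hle⟩, hcluster.tendsto_subseq⟩

theorem iInf_le_iff (H : KInfCompact D h) (x : S) {C : ℝ≥0∞} (hC : C ≠ ⊤) :
    (⨅ a ∈ D x, h (x, a)) ≤ C ↔ ∃ a ∈ D x, h (x, a) ≤ C := by
  refine ⟨fun hle => ?_, fun ⟨a, ha, hle⟩ => iInf₂_le_of_le a ha hle⟩
  obtain ⟨c, hc_anti, hc, hc_lim⟩ := exists_seq_strictAnti_tendsto' hC.lt_top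
  obtain ⟨a, ha⟩ := IsCompact.nonempty_iInter_of_sequence_nonempty_isCompact_isClosed
    (fun n => {a | a ∈ D x ∧ h (x, a) ≤ c n})
    (fun n a ha => ⟨ha.1, ha.2.trans (hc_anti n.lt_succ_self).le⟩)
    (fun n => by
      obtain ⟨a, ha, hlt⟩ := by simpa only [iInf_lt_iff] using hle.trans_lt (hc n).1
      exact ⟨a, ha, hlt.le⟩)
    (H.isCompact_setOf_le x (hc 0).2.ne) (fun n => (H.isCompact_setOf_le x (hc n).2.ne).isClosed)
  have hmem := Set.mem_iInter.1 ha
  exact ⟨a, (hmem 0).1, ge_of_tendsto' hc_lim fun n => (hmem n).2⟩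

theorem lowerSemicontinuous_iInf [FirstCountableTopology S] (H : KInfCompact D h) :
    LowerSemicontinuous fun x => ⨅ a ∈ D x, h (x, a) := by
  rw [lowerSemicontinuous_iff_isClosed_preimage]
  intro C
  rcases eq_or_ne C ⊤ with rfl | hC
  · simp
  refine IsSeqClosed.isClosed fun x x₀ hx hx₀ => ?_
  choose a ha hle using fun n => (H.iInf_le_iff (x n) hC).1 (hx n)
  obtain ⟨a₀, ha₀, -, hle₀⟩ := H hx₀ ha hC hle
  exact (H.iInf_le_iff x₀ hC).2 ⟨a₀, ha₀, hle₀⟩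

theorem exists_measurable_argmin [FirstCountableTopology S] [MeasurableSpace S]
    [OpensMeasurableSpace S] [SecondCountableTopology Y] [MeasurableSpace Y] [BorelSpace Y]
    (H : KInfCompact D h) (hfin : ∀ x, (⨅ a ∈ D x, h (x, a)) ≠ ⊤) :
    ∃ f : S → Y, Measurable f ∧ ∀ x, f x ∈ D x ∧ h (x, f x) = ⨅ a ∈ D x, h (x, a) := by
  have hargmin : IsMeasurableCompactMap fun x => {a | a ∈ D x ∧ h (x, a) ≤ ⨅ b ∈ D x, h (x, b)} :=
    { isCompact := fun x => H.isCompact_setOf_le x (hfin x)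
      nonempty := fun x => (H.iInf_le_iff x (hfin x)).1 le_rfl
      measurableSet := fun F hF => by
        have hmeets : {x | ({a | a ∈ D x ∧ h (x, a) ≤ ⨅ b ∈ D x, h (x, b)} ∩ F).Nonempty}
            = {x | (⨅ a ∈ D x ∩ F, h (x, a)) ≤ ⨅ b ∈ D x, h (x, b)} := by
          ext x
          refine Iff.trans ?_ ((H.inter hF).iInf_le_iff x (hfin x)).symm
          exact exists_congr fun a => and_right_comm
        rw [hmeets]
        exact measurableSet_le (H.inter hF).lowerSemicontinuous_iInf.measurable
          H.lowerSemicontinuous_iInf.measurable }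
  obtain ⟨f, hf, hmem⟩ := hargmin.exists_measurable_selector
  exact ⟨f, hf, fun x => ⟨(hmem x).1, le_antisymm (hmem x).2 (iInf₂_le _ (hmem x).1)⟩⟩

end KInfCompact

end KInfCompact

section Trajectories

open Preorder

section Uniqueness

variable {Y : ℕ → Type*} [∀ n, MeasurableSpace (Y n)]

theorem measure_ext_of_map_frestrictLe {μ ν : Measure (Π n, Y n)} [IsFiniteMeasure ν]
    (h : ∀ n, μ.map (frestrictLe n) = ν.map (frestrictLe n)) : μ = ν := by
  have hν : IsProjectiveLimit ν fun I => ν.map I.restrict := fun _ => rfl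
  have hν_proj : IsProjectiveMeasureFamily fun I => ν.map I.restrict := fun I J hJI => by
    rw [Measure.map_map (by fun_prop) (by fun_prop), Finset.restrict₂_comp_restrict]
  exact ((isProjectiveLimit_nat_iff hν_proj μ).2 h).unique hν

theorem frestrictLe_succ_eq_IicProdIoc_comp (n : ℕ) :
    frestrictLe (π := Y) (n + 1) = (IicProdIoc n (n + 1) ∘
      Prod.map id (MeasurableEquiv.piSingleton n)) ∘ fun ω => (frestrictLe n ω, ω (n + 1)) := by
  funext ω ⟨i, hi⟩
  by_cases hin : i ≤ n
  · simp [IicProdIoc_def, hin]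
  · obtain rfl : i = n + 1 := le_antisymm (Finset.mem_Iic.1 hi) (not_le.1 hin)
    simp [IicProdIoc_def, MeasurableEquiv.piSingleton]

theorem map_frestrictLe_zero_trajMeasure (μ₀ : Measure (Y 0))
    (κ : (n : ℕ) → Kernel (Π i : Finset.Iic n, Y i) (Y (n + 1))) [∀ n, IsMarkovKernel (κ n)] :
    (Kernel.trajMeasure μ₀ κ).map (frestrictLe 0)
      = μ₀.map (MeasurableEquiv.piUnique fun i : Finset.Iic 0 => Y i).symm := by
  rw [Kernel.trajMeasure, Measure.map_comp _ _ (by fun_prop), Kernel.traj_map_frestrictLe,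
    Kernel.partialTraj_self, Measure.id_comp]
  rfl

theorem eq_trajMeasure_of_map_compProd {μ : Measure (Π n, Y n)} {μ₀ : Measure (Y 0)}
    [IsProbabilityMeasure μ₀] {κ : (n : ℕ) → Kernel (Π i : Finset.Iic n, Y i) (Y (n + 1))}
    [∀ n, IsMarkovKernel (κ n)] (h_zero : μ.map (fun ω => ω 0) = μ₀)
    (h_succ : ∀ n, μ.map (frestrictLe n) ⊗ₘ κ n = μ.map fun ω => (frestrictLe n ω, ω (n + 1))) :
    μ = Kernel.trajMeasure μ₀ κ := by
  refine measure_ext_of_map_frestrictLe fun n => ?_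
  induction n with
  | zero =>
    have h_eval : Measurable fun ω : (Π n, Y n) => ω 0 := measurable_pi_apply 0
    rw [map_frestrictLe_zero_trajMeasure, ← h_zero]
    refine Eq.trans ?_ (Measure.map_map (MeasurableEquiv.measurable _) h_eval).symm
    congr 1
    funext ω ⟨i, hi⟩
    obtain rfl : i = 0 := Nat.le_zero.1 (Finset.mem_Iic.1 hi)
    rfl
  | succ n ih =>
    have h_glue : Measurable (IicProdIoc (X := Y) n (n + 1) ∘
        Prod.map id (MeasurableEquiv.piSingleton n)) :=
      measurable_IicProdIoc.comp (by fun_prop)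
    rw [frestrictLe_succ_eq_IicProdIoc_comp, ← Measure.map_map h_glue (by fun_prop),
      ← Measure.map_map h_glue (by fun_prop), ← h_succ, ih,
      Kernel.map_frestrictLe_trajMeasure_compProd_eq_map_trajMeasure]

end Uniqueness

section Shift

variable {Y : Type*} [MeasurableSpace Y] (κ : (n : ℕ) → Kernel ((i : Finset.Iic n) → Y) Y)
  [∀ n, IsMarkovKernel (κ n)]

theorem lintegral_trajMeasure (μ₀ : Measure Y) {F : (ℕ → Y) → ℝ≥0∞} (hF : Measurable F) :
    ∫⁻ ω, F ω ∂(Kernel.trajMeasure (X := fun _ => Y) μ₀ κ)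
      = ∫⁻ y, ∫⁻ ω, F ω ∂(Kernel.traj (X := fun _ => Y) κ 0 fun _ => y) ∂μ₀ := by
  rw [Kernel.trajMeasure, Measure.lintegral_bind (Kernel.aemeasurable _) hF.aemeasurable,
    lintegral_map hF.lintegral_kernel (by fun_prop)]
  rfl

theorem traj_zero_eq_trajMeasure_dirac (z : Y) :
    Kernel.traj (X := fun _ => Y) κ 0 (fun _ => z)
      = Kernel.trajMeasure (X := fun _ => Y) (Measure.dirac z) κ := by
  rw [Kernel.trajMeasure, Measure.map_dirac' (by fun_prop),
    Measure.dirac_bind (Kernel.measurable _)]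
  rfl

theorem map_traj_zero_eq_dirac (z : Y) :
    (Kernel.traj (X := fun _ => Y) κ 0 fun _ => z).map (fun ω => ω 0) = Measure.dirac z := by
  have h_comp : (fun ω : ℕ → Y => ω 0)
      = (fun h : (i : Finset.Iic 0) → Y => h ⟨0, Finset.mem_Iic.2 le_rfl⟩) ∘ frestrictLe 0 := rfl
  rw [h_comp, ← Measure.map_map (by fun_prop) (by fun_prop), Kernel.traj_map_frestrictLe_apply,
    Kernel.partialTraj_self, Kernel.id_apply, Measure.map_dirac' (by fun_prop)]

theorem ae_traj_zero_eq [MeasurableSingletonClass Y] (z : Y) :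
    ∀ᵐ ω ∂(Kernel.traj (X := fun _ => Y) κ 0 fun _ => z), ω 0 = z := by
  have h_dirac : ∀ᵐ y ∂(Kernel.traj (X := fun _ => Y) κ 0 fun _ => z).map (fun ω => ω 0),
      y = z := by
    rw [map_traj_zero_eq_dirac, ae_dirac_eq]
    exact mem_pure.2 rfl
  exact ae_of_ae_map (measurable_pi_apply 0).aemeasurable h_dirac

/-- The history `h` preceded by `z`. -/
def consIic {Y : Type*} {n : ℕ} (z : Y) (h : (i : Finset.Iic n) → Y) :
    (i : Finset.Iic (n + 1)) → Y
  | ⟨0, _⟩ => z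
  | ⟨i + 1, hi⟩ => h ⟨i, Finset.mem_Iic.2 (Nat.succ_le_succ_iff.1 (Finset.mem_Iic.1 hi))⟩

theorem frestrictLe_succ_eq_consIic {Y : Type*} (n : ℕ) (ω : ℕ → Y) :
    frestrictLe (π := fun _ => Y) (n + 1) ω
      = consIic (ω 0) (frestrictLe (π := fun _ => Y) n fun k => ω (k + 1)) := by
  funext ⟨i, _⟩
  cases i <;> rfl

theorem map_shift_traj_compProd [MeasurableSingletonClass Y]
    {κ' : (n : ℕ) → Kernel ((i : Finset.Iic n) → Y) Y} [∀ n, IsMarkovKernel (κ' n)] {z : Y}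
    (hκ : ∀ n w, κ' n w = κ (n + 1) (consIic z w)) (n : ℕ) :
    (Kernel.traj (X := fun _ => Y) κ 0 fun _ => z).map
        (fun ω => frestrictLe (π := fun _ => Y) n fun k => ω (k + 1)) ⊗ₘ κ' n
      = (Kernel.traj (X := fun _ => Y) κ 0 fun _ => z).map
        fun ω => (frestrictLe (π := fun _ => Y) n fun k => ω (k + 1), ω (n + 1 + 1)) := by
  set Q := Kernel.traj (X := fun _ => Y) κ 0 fun _ => z with hQ
  let tail : ((i : Finset.Iic (n + 1)) → Y) → ((i : Finset.Iic n) → Y) := fun w i =>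
    w ⟨i + 1, Finset.mem_Iic.2 (Nat.succ_le_succ (Finset.mem_Iic.1 i.2))⟩
  have htail : Measurable tail := by fun_prop
  have h_unshifted : Q.map (frestrictLe (π := fun _ => Y) (n + 1)) ⊗ₘ κ (n + 1)
      = Q.map fun ω => (frestrictLe (π := fun _ => Y) (n + 1) ω, ω (n + 1 + 1)) := by
    rw [hQ, traj_zero_eq_trajMeasure_dirac]
    exact Kernel.map_frestrictLe_trajMeasure_compProd_eq_map_trajMeasure
  calc _ = (Q.map (frestrictLe (π := fun _ => Y) (n + 1)) ⊗ₘ κ (n + 1)).map (Prod.map tail id) := by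
        ext s hs
        rw [Measure.map_apply (by fun_prop) hs, Measure.compProd_apply hs,
          Measure.compProd_apply (hs.preimage (by fun_prop)),
          lintegral_map (Kernel.measurable_kernel_prodMk_left hs) (by fun_prop),
          lintegral_map (Kernel.measurable_kernel_prodMk_left (hs.preimage (by fun_prop)))
            (by fun_prop)]
        refine lintegral_congr_ae ((ae_traj_zero_eq κ z).mono fun ω hω => ?_)
        beta_reduce
        rw [hκ, ← hω, ← frestrictLe_succ_eq_consIic]
        rfl
    _ = _ := by rw [h_unshifted, Measure.map_map (by fun_prop) (by fun_prop)]; rfl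

theorem map_shift_traj [MeasurableSingletonClass Y]
    {κ' : (n : ℕ) → Kernel ((i : Finset.Iic n) → Y) Y} [∀ n, IsMarkovKernel (κ' n)] {z : Y}
    (hκ : ∀ n w, κ' n w = κ (n + 1) (consIic z w)) :
    (Kernel.traj (X := fun _ => Y) κ 0 fun _ => z).map (fun ω n => ω (n + 1))
      = Kernel.trajMeasure (X := fun _ => Y) (κ 0 fun _ => z) κ' := by
  refine eq_trajMeasure_of_map_compProd (Y := fun _ => Y) ?_ fun n => ?_
  · rw [Measure.map_map (by fun_prop) (by fun_prop),
      ← Kernel.map_traj_succ_self (X := fun _ => Y) (κ := κ), Kernel.map_apply _ (by fun_prop)]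
    rfl
  · rw [Measure.map_map (by fun_prop) (by fun_prop), Measure.map_map (by fun_prop) (by fun_prop)]
    exact map_shift_traj_compProd κ hκ n

end Shift

end Trajectories

namespace MDP

section FirstStep

variable {X A : Type*} [MeasurableSpace X] [MeasurableSpace A] (M : MDP X A) (π : M.Policy)

theorem measurableSet_actions (x : X) : MeasurableSet (M.actions x) :=
  M.measurableSet_graph.preimage measurable_prodMk_left

theorem transKernel_apply {p : X × A} (hp : p ∈ M.graph) : M.transKernel p = M.trans p :=
  if_pos hp

variable {M} in
theorem ae_rule_mem_actions (n : ℕ) (h : (Fin n → X × A) × X) :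
    ∀ᵐ a ∂(π.rule n h), a ∈ M.actions h.2 := by
  have := π.isMarkovKernel_rule n
  exact (mem_ae_iff_prob_eq_one (M.measurableSet_actions _)).2 (π.rule_actions n h)

theorem measurable_prodMk_finCons {Y Z : Type*} [MeasurableSpace Y] [MeasurableSpace Z] (n : ℕ)
    (z : Y) : Measurable fun h : (Fin n → Y) × Z => ((Fin.cons z h.1 : Fin (n + 1) → Y), h.2) := by
  refine (measurable_pi_iff.2 fun i => ?_).prodMk measurable_snd
  cases i using Fin.cases with
  | zero => simp only [Fin.cons_zero, measurable_const]
  | succ j => simp only [Fin.cons_succ]; fun_prop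

variable {M} in
/-- The policy that `π` induces after the first state-action pair `z` has been observed. -/
noncomputable def Policy.shift (z : X × A) : M.Policy where
  rule n := (π.rule (n + 1)).comap
    (fun h : (Fin n → X × A) × X => ((Fin.cons z h.1 : Fin (n + 1) → X × A), h.2))
    (measurable_prodMk_finCons n z)
  isMarkovKernel_rule n := by
    have := π.isMarkovKernel_rule (n + 1)
    infer_instance
  rule_actions n _ := π.rule_actions (n + 1) _

theorem StationaryPolicy.shift_toPolicy {M : MDP X A} (φ : M.StationaryPolicy) (z : X × A) :
    φ.toPolicy.shift z = φ.toPolicy := by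
  unfold Policy.shift StationaryPolicy.toPolicy
  congr 1

instance (x : X) : IsProbabilityMeasure (M.initialLaw π x) := by
  have := π.isMarkovKernel_rule 0
  exact Measure.isProbabilityMeasure_map (by fun_prop)

instance (x : X) : IsProbabilityMeasure (M.pathMeasure π x) := by
  unfold pathMeasure
  infer_instance

/-- The law of the trajectory that starts with the state-action pair `z`. -/
noncomputable def pairMeasure (z : X × A) : Measure (ℕ → X × A) :=
  Kernel.traj (X := fun _ => X × A) (M.stepKernel π) 0 (fun _ => z)

instance (z : X × A) : IsProbabilityMeasure (M.pairMeasure π z) := by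
  unfold pairMeasure
  infer_instance

theorem measurable_lintegral_pairMeasure {F : (ℕ → X × A) → ℝ≥0∞} (hF : Measurable F) :
    Measurable fun z => ∫⁻ ω, F ω ∂(M.pairMeasure π z) :=
  (hF.lintegral_kernel (κ := Kernel.traj (X := fun _ => X × A) (M.stepKernel π) 0)).comp
    (measurable_pi_iff.2 fun _ => measurable_id)

theorem lintegral_pathMeasure (x : X) {F : (ℕ → X × A) → ℝ≥0∞} (hF : Measurable F) :
    ∫⁻ ω, F ω ∂(M.pathMeasure π x)
      = ∫⁻ a, ∫⁻ ω, F ω ∂(M.pairMeasure π (x, a)) ∂(π.rule 0 (Fin.elim0, x)) := by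
  rw [pathMeasure, lintegral_trajMeasure _ _ hF]
  exact lintegral_map (M.measurable_lintegral_pairMeasure π hF) (by fun_prop)

theorem stepKernel_shift (z : X × A) (n : ℕ) (w : (i : Finset.Iic n) → X × A) :
    M.stepKernel (π.shift z) n w = M.stepKernel π (n + 1) (consIic z w) := by
  have := π.isMarkovKernel_rule (n + 2)
  have := (π.shift z).isMarkovKernel_rule (n + 1)
  ext s hs
  unfold stepKernel
  rw [Kernel.compProd_apply hs, Kernel.compProd_apply hs]
  simp only [Kernel.comap_apply, Policy.shift]
  refine lintegral_congr fun y => ?_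
  congr 3
  exact funext <| Fin.cases rfl fun _ => rfl

theorem lintegral_stepKernel_zero (z : X × A) {G : X × A → ℝ≥0∞} (hG : Measurable G) :
    ∫⁻ p, G p ∂(M.stepKernel π 0 fun _ => z)
      = ∫⁻ y, ∫⁻ b, G (y, b) ∂((π.shift z).rule 0 (Fin.elim0, y)) ∂(M.transKernel z) := by
  have := π.isMarkovKernel_rule 1
  rw [stepKernel, Kernel.lintegral_compProd _ _ _ hG]
  simp only [Kernel.comap_apply, Policy.shift]
  refine lintegral_congr fun y => ?_
  congr 3
  exact funext <| Fin.cases rfl fun i => i.elim0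

variable [MeasurableSingletonClass X] [MeasurableSingletonClass A]

theorem lintegral_shift_pairMeasure (z : X × A) {F : (ℕ → X × A) → ℝ≥0∞} (hF : Measurable F) :
    ∫⁻ ω, F (fun n => ω (n + 1)) ∂(M.pairMeasure π z)
      = ∫⁻ y, ∫⁻ ω, F ω ∂(M.pathMeasure (π.shift z) y) ∂(M.transKernel z) := by
  rw [← lintegral_map (f := F) hF (by fun_prop), pairMeasure,
    map_shift_traj (M.stepKernel π) (M.stepKernel_shift π z), lintegral_trajMeasure _ _ hF]
  simp only [lintegral_pathMeasure _ _ _ hF]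
  exact M.lintegral_stepKernel_zero π z (M.measurable_lintegral_pairMeasure (π.shift z) hF)

theorem lintegral_zero_pairMeasure (z : X × A) (f : X × A → ℝ≥0∞) :
    ∫⁻ ω, f (ω 0) ∂(M.pairMeasure π z) = f z := by
  have h_init : (fun ω => f (ω 0)) =ᵐ[M.pairMeasure π z] fun _ => f z :=
    (ae_traj_zero_eq (M.stepKernel π) z).mono fun _ => congrArg f
  rw [lintegral_congr_ae h_init, lintegral_const, measure_univ, mul_one]

theorem lintegral_pathMeasure_add_shift (x : X) {f : X × A → ℝ≥0∞} (hf : Measurable f)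
    {F : (ℕ → X × A) → ℝ≥0∞} (hF : Measurable F) :
    ∫⁻ ω, (f (ω 0) + F fun n => ω (n + 1)) ∂(M.pathMeasure π x)
      = ∫⁻ a, (f (x, a) + ∫⁻ y, ∫⁻ ω, F ω ∂(M.pathMeasure (π.shift (x, a)) y)
          ∂(M.trans (x, a))) ∂(π.rule 0 (Fin.elim0, x)) := by
  rw [lintegral_pathMeasure _ _ _ (by fun_prop)]
  refine lintegral_congr_ae ((ae_rule_mem_actions π 0 _).mono fun a ha => ?_)
  beta_reduce
  rw [lintegral_add_left (by fun_prop), lintegral_zero_pairMeasure,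
    lintegral_shift_pairMeasure _ _ _ hF, transKernel_apply _ ha]

theorem lintegral_pathMeasure_eq_zero {f : X × A → ℝ≥0∞} (hf : Measurable f)
    (hf_zero : ∀ p ∈ M.graph, f p = 0) (n : ℕ) (x : X) :
    ∫⁻ ω, f (ω n) ∂(M.pathMeasure π x) = 0 := by
  induction n generalizing π x with
  | zero =>
    have h_step := M.lintegral_pathMeasure_add_shift π x hf (F := 0) measurable_zero
    simp only [Pi.zero_apply, add_zero, lintegral_zero] at h_step
    rw [h_step, lintegral_eq_zero_iff (by fun_prop)]
    exact (ae_rule_mem_actions π 0 (Fin.elim0, x)).mono fun a ha => hf_zero (x, a) ha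
  | succ n ih =>
    have h_step := M.lintegral_pathMeasure_add_shift π x (f := 0) measurable_zero
      (F := fun ω => f (ω n)) (by fun_prop)
    simpa only [Pi.zero_apply, zero_add, ih, lintegral_zero] using h_step

theorem ae_mem_graph (x : X) : ∀ᵐ ω ∂(M.pathMeasure π x), ∀ n, ω n ∈ M.graph := by
  have h_meas : Measurable (M.graphᶜ.indicator (1 : X × A → ℝ≥0∞)) :=
    measurable_one.indicator M.measurableSet_graph.compl
  refine ae_all_iff.2 fun n => ?_
  have h_zero := M.lintegral_pathMeasure_eq_zero π h_meas
    (fun p hp => Set.indicator_of_notMem (Set.notMem_compl_iff.2 hp) _) n x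
  filter_upwards [(lintegral_eq_zero_iff (by fun_prop)).1 h_zero] with ω hω
  simpa using hω

end FirstStep

section NonnegativeCosts

variable {X A : Type*} [MeasurableSpace X] [MeasurableSpace A] (M : MDP X A) (r : X × A → ℝ≥0∞)
  (π : M.Policy) (a : ℝ≥0∞) (x : X)

/-- `v_N^π(x)` for a one-step cost `r` with values in `[0, ∞]`. -/
noncomputable def ennHorizonCost (N : ℕ) : ℝ≥0∞ :=
  ∫⁻ ω, ∑ n ∈ Finset.range N, r (ω n) ∂(M.pathMeasure π x)

/-- `v_a^π(x)` for a one-step cost `r` with values in `[0, ∞]`. -/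
noncomputable def ennDiscCost : ℝ≥0∞ :=
  ∫⁻ ω, ∑' n, a ^ n * r (ω n) ∂(M.pathMeasure π x)

/-- `w^π(x)` for a one-step cost `r` with values in `[0, ∞]`. -/
noncomputable def ennAvgCost : ℝ≥0∞ :=
  limsup (fun N : ℕ => (N : ℝ≥0∞)⁻¹ * M.ennHorizonCost r π x N) atTop

/-- `v_a(x)` for a one-step cost `r` with values in `[0, ∞]`. -/
noncomputable def ennDiscValue : ℝ≥0∞ := ⨅ π : M.Policy, M.ennDiscCost r π a x

/-- `m_a` for a one-step cost `r` with values in `[0, ∞]`. -/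
noncomputable def ennMinDisc : ℝ≥0∞ := ⨅ x, M.ennDiscValue r a x

/-- `u_a(x)` for a one-step cost `r` with values in `[0, ∞]`. -/
noncomputable def ennRelDisc : ℝ≥0∞ := M.ennDiscValue r a x - M.ennMinDisc r a

/-- `w̄` for a one-step cost `r` with values in `[0, ∞]`. -/
noncomputable def ennWBar : ℝ≥0∞ :=
  limsup (fun a : ℝ≥0∞ => (1 - a) * M.ennMinDisc r a) (𝓝[<] 1)

/-- `r(x, b) + ∫ f dq(· | x, b)` at the state-action pair `p = (x, b)`, as a lower integral when `f`
is not measurable. -/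
noncomputable def ennOneStep (f : X → ℝ≥0∞) (p : X × A) : ℝ≥0∞ := r p + ∫⁻ y, f y ∂(M.trans p)

theorem ennMinDisc_le_ennDiscValue : M.ennMinDisc r a ≤ M.ennDiscValue r a x := iInf_le _ x

theorem ennDiscValue_le_ennDiscCost : M.ennDiscValue r a x ≤ M.ennDiscCost r π a x := iInf_le _ π

theorem ennRelDisc_add_ennMinDisc :
    M.ennRelDisc r a x + M.ennMinDisc r a = M.ennDiscValue r a x :=
  tsub_add_cancel_of_le (M.ennMinDisc_le_ennDiscValue r a x)

variable {r a}

theorem limsup_ennDiscCost_le_ennAvgCost (hr : Measurable r) :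
    limsup (fun a : ℝ≥0∞ => (1 - a) * M.ennDiscCost r π a x) (𝓝[<] 1)
      ≤ M.ennAvgCost r π x := by
  have h_horizon : ∀ N, M.ennHorizonCost r π x N
      = ∑ n ∈ Finset.range N, ∫⁻ ω, r (ω n) ∂(M.pathMeasure π x) := fun N =>
    lintegral_finsetSum _ fun n _ => by fun_prop
  have h_disc : ∀ a : ℝ≥0∞, M.ennDiscCost r π a x
      = ∑' n, a ^ n * ∫⁻ ω, r (ω n) ∂(M.pathMeasure π x) := fun a => by
    rw [ennDiscCost, lintegral_tsum fun n => Measurable.aemeasurable (by fun_prop)]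
    exact tsum_congr fun n => lintegral_const_mul _ (by fun_prop)
  simp only [ennAvgCost, h_horizon, h_disc]
  exact limsup_abel_mean_le_limsup_cesaro_mean _

theorem limsup_ennDiscValue_le_ennAvgCost (hr : Measurable r) :
    limsup (fun a : ℝ≥0∞ => (1 - a) * M.ennDiscValue r a x) (𝓝[<] 1) ≤ M.ennAvgCost r π x :=
  (limsup_le_limsup (.of_forall fun a =>
    mul_le_mul_right (M.ennDiscValue_le_ennDiscCost r π a x) _)).trans
    (M.limsup_ennDiscCost_le_ennAvgCost π x hr)

variable (r) in
theorem ennWBar_le_limsup_ennDiscValue :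
    M.ennWBar r ≤ limsup (fun a : ℝ≥0∞ => (1 - a) * M.ennDiscValue r a x) (𝓝[<] 1) :=
  limsup_le_limsup (.of_forall fun a =>
    mul_le_mul_right (M.ennMinDisc_le_ennDiscValue r a x) _)

theorem eventually_ennMinDisc_ne_top (h : M.ennWBar r < ⊤) :
    ∀ᶠ a : ℝ≥0∞ in 𝓝[<] 1, M.ennMinDisc r a ≠ ⊤ := by
  filter_upwards [eventually_lt_of_limsup_lt h, self_mem_nhdsWithin] with a ha_lt ha
  rintro h_top
  rw [h_top, ENNReal.mul_top (tsub_pos_of_lt ha).ne'] at ha_lt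
  exact ha_lt.ne rfl

variable [MeasurableSingletonClass X] [MeasurableSingletonClass A]

theorem ennDiscCost_eq_lintegral (hr : Measurable r) (ha : a ≠ ⊤) :
    M.ennDiscCost r π a x = ∫⁻ b, (r (x, b)
      + a * ∫⁻ y, M.ennDiscCost r (π.shift (x, b)) a y ∂(M.trans (x, b)))
        ∂(π.rule 0 (Fin.elim0, x)) := by
  have h_meas : Measurable fun ω : ℕ → X × A => ∑' n, a ^ n * r (ω n) := by fun_prop
  have h_step := M.lintegral_pathMeasure_add_shift π x hr (h_meas.const_mul a)
  simp only [lintegral_const_mul _ h_meas, lintegral_const_mul' _ _ ha] at h_step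
  refine Eq.trans (lintegral_congr fun ω => ?_) h_step
  rw [tsum_eq_zero_add' ENNReal.summable, pow_zero, one_mul, ← ENNReal.tsum_mul_left]
  simp only [pow_succ', mul_assoc]

theorem exists_add_mul_lintegral_ennDiscValue_le (hr : Measurable r) (ha : a ≠ ⊤) {C : ℝ≥0∞}
    (hC : M.ennDiscValue r a x < C) :
    ∃ b ∈ M.actions x,
      r (x, b) + a * ∫⁻ y, M.ennDiscValue r a y ∂(M.trans (x, b)) ≤ C := by
  obtain ⟨π, hπ⟩ := iInf_lt_iff.1 hC
  rw [M.ennDiscCost_eq_lintegral π x hr ha] at hπ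
  have := π.isMarkovKernel_rule 0
  by_contra! h_lt
  refine hπ.not_ge ?_
  calc C = ∫⁻ _, C ∂(π.rule 0 (Fin.elim0, x)) := by simp
    _ ≤ _ := lintegral_mono_ae <|
      (ae_rule_mem_actions π 0 (Fin.elim0, x)).mono fun b hb => (h_lt b hb).le.trans <| by
        gcongr with y
        exact M.ennDiscValue_le_ennDiscCost r _ a y

theorem exists_ennOneStep_smul_ennRelDisc_le (hr : Measurable r) (ha : a ≤ 1)
    (hmin : M.ennMinDisc r a ≠ ⊤) {C : ℝ≥0∞}
    (hC : M.ennRelDisc r a x + (1 - a) * M.ennMinDisc r a < C) :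
    ∃ b ∈ M.actions x, M.ennOneStep r (a • M.ennRelDisc r a) (x, b) ≤ C := by
  have ha_top : a ≠ ⊤ := ne_top_of_le_ne_top ENNReal.one_ne_top ha
  have hmul_top : a * M.ennMinDisc r a ≠ ⊤ := ENNReal.mul_ne_top ha_top hmin
  have h_value : M.ennDiscValue r a x < C + a * M.ennMinDisc r a := by
    have h := ENNReal.add_lt_add_right hmul_top hC
    rwa [add_assoc, ← add_mul, tsub_add_cancel_of_le ha, one_mul,
      ennRelDisc_add_ennMinDisc] at h
  obtain ⟨b, hb, hb_le⟩ := M.exists_add_mul_lintegral_ennDiscValue_le x hr ha_top h_value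
  have := M.isProbabilityMeasure_trans (x, b)
  refine ⟨b, hb, (ENNReal.add_le_add_iff_right hmul_top).1 (le_of_eq_of_le ?_ hb_le)⟩
  simp only [ennOneStep, Pi.smul_apply, smul_eq_mul, ← M.ennRelDisc_add_ennMinDisc r a]
  rw [lintegral_add_right _ measurable_const, lintegral_const, measure_univ, mul_one,
    lintegral_const_mul' _ _ ha_top, mul_add, add_assoc]

theorem ennHorizonCost_toPolicy_succ (hr : Measurable r) (φ : M.StationaryPolicy) (N : ℕ) :
    M.ennHorizonCost r φ.toPolicy x (N + 1)
      = M.ennOneStep r (fun y => M.ennHorizonCost r φ.toPolicy y N) (x, φ.toFun x) := by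
  have h_step := M.lintegral_pathMeasure_add_shift φ.toPolicy x hr
    (F := fun ω => ∑ n ∈ Finset.range N, r (ω n)) (by fun_prop)
  have h_rule : φ.toPolicy.rule 0 (Fin.elim0, x) = Measure.dirac (φ.toFun x) :=
    Kernel.deterministic_apply (φ.measurable.comp measurable_snd) _
  simp only [φ.shift_toPolicy, h_rule, lintegral_dirac] at h_step
  refine Eq.trans (lintegral_congr fun ω => ?_) h_step
  rw [Finset.sum_range_succ', add_comm]

section OptimalityInequality

variable {u : X → ℝ≥0∞} {w : ℝ≥0∞}

theorem ennHorizonCost_toPolicy_le (hr : Measurable r) (φ : M.StationaryPolicy)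
    (h : ∀ x, M.ennOneStep r u (x, φ.toFun x) ≤ w + u x) (N : ℕ) :
    M.ennHorizonCost r φ.toPolicy x N ≤ N * w + u x := by
  induction N generalizing x with
  | zero => simp [ennHorizonCost]
  | succ N ih =>
    have := M.isProbabilityMeasure_trans (x, φ.toFun x)
    calc M.ennHorizonCost r φ.toPolicy x (N + 1)
        ≤ M.ennOneStep r (fun y => N * w + u y) (x, φ.toFun x) := by
          rw [M.ennHorizonCost_toPolicy_succ x hr]
          exact add_le_add_right (lintegral_mono ih) _
      _ = N * w + M.ennOneStep r u (x, φ.toFun x) := by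
          rw [ennOneStep, ennOneStep, lintegral_add_left measurable_const, lintegral_const,
            measure_univ, mul_one, add_left_comm]
      _ ≤ N * w + (w + u x) := add_le_add_right (h x) _
      _ = (N + 1 : ℕ) * w + u x := by push_cast; ring

theorem ennAvgCost_toPolicy_le (hr : Measurable r) (φ : M.StationaryPolicy)
    (h : ∀ x, M.ennOneStep r u (x, φ.toFun x) ≤ w + u x) (hx : u x ≠ ⊤) :
    M.ennAvgCost r φ.toPolicy x ≤ w := by
  have hlim : Tendsto (fun N : ℕ => w + (N : ℝ≥0∞)⁻¹ * u x) atTop (𝓝 w) := by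
    simpa using (ENNReal.Tendsto.mul_const ENNReal.tendsto_inv_nat_nhds_zero
      (Or.inr hx)).const_add w
  rw [← hlim.limsup_eq]
  refine limsup_le_limsup ((eventually_ge_atTop 1).mono fun N hN => ?_)
  have hN_ne : (N : ℝ≥0∞) ≠ 0 := Nat.cast_ne_zero.2 (by lia)
  calc (N : ℝ≥0∞)⁻¹ * M.ennHorizonCost r φ.toPolicy x N
      ≤ (N : ℝ≥0∞)⁻¹ * (N * w + u x) :=
        mul_le_mul_right (M.ennHorizonCost_toPolicy_le x hr φ h N) _
    _ = w + (N : ℝ≥0∞)⁻¹ * u x := by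
        rw [mul_add, ← mul_assoc, ENNReal.inv_mul_cancel hN_ne (ENNReal.natCast_ne_top N),
          one_mul]

end OptimalityInequality

end NonnegativeCosts

section RelativeLimit

variable {X A : Type*} [MeasurableSpace X] [MeasurableSpace A] [TopologicalSpace X]

/-- `u(x)` for a one-step cost `r` with values in `[0, ∞]`. -/
noncomputable def ennRelLimit (M : MDP X A) (r : X × A → ℝ≥0∞) (x : X) : ℝ≥0∞ :=
  liminf (fun p : ℝ≥0∞ × X => M.ennRelDisc r p.1 p.2) (𝓝[<] 1 ×ˢ 𝓝 x)

variable {M : MDP X A} {r : X × A → ℝ≥0∞}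

theorem lowerSemicontinuous_ennRelLimit : LowerSemicontinuous (M.ennRelLimit r) :=
  lowerSemicontinuous_liminf_prod_nhds _ _

theorem ennRelLimit_le_liminf_smul {a : ℕ → ℝ≥0∞} (ha : Tendsto a atTop (𝓝[<] 1)) (y : X) :
    M.ennRelLimit r y
      ≤ liminf (fun p : ℕ × X => (a p.1 • M.ennRelDisc r (a p.1)) p.2) (atTop ×ˢ 𝓝 y) := by
  have h_comp : M.ennRelLimit r y
      ≤ liminf (fun p : ℕ × X => M.ennRelDisc r (a p.1) p.2) (atTop ×ˢ 𝓝 y) :=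
    liminf_le_liminf_of_le (u := fun p : ℝ≥0∞ × X => M.ennRelDisc r p.1 p.2)
      (g := map (Prod.map a id) (atTop ×ˢ 𝓝 y)) (ha.prodMap tendsto_id)
  have h_one : liminf (fun p : ℕ × X => a p.1) (atTop ×ˢ 𝓝 y) = 1 :=
    ((tendsto_nhdsWithin_iff.1 ha).1.comp tendsto_fst).liminf_eq
  calc M.ennRelLimit r y
      ≤ liminf (fun p : ℕ × X => a p.1) (atTop ×ˢ 𝓝 y)
        * liminf (fun p : ℕ × X => M.ennRelDisc r (a p.1) p.2) (atTop ×ˢ 𝓝 y) := by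
        rwa [h_one, one_mul]
    _ ≤ _ := ENNReal.le_liminf_mul

theorem frequently_exists_ennOneStep_smul_ennRelDisc_le [MeasurableSingletonClass X]
    [MeasurableSingletonClass A] (hr : Measurable r) {x : X} {C : ℝ≥0∞}
    (hC : M.ennWBar r + M.ennRelLimit r x < C) :
    ∃ᶠ p : ℝ≥0∞ × X in 𝓝[<] 1 ×ˢ 𝓝 x,
      ∃ b ∈ M.actions p.2, M.ennOneStep r (p.1 • M.ennRelDisc r p.1) (p.2, b) ≤ C := by
  obtain ⟨e, h_bar, h_rel⟩ := exists_between (lt_tsub_iff_right.2 hC)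
  replace h_rel : M.ennRelLimit r x < C - e := lt_tsub_iff_left.2 (lt_tsub_iff_right.1 h_rel)
  have h_below : ∀ᶠ a : ℝ≥0∞ in 𝓝[<] 1, a < 1 := self_mem_nhdsWithin
  have h_min := (h_below.and (eventually_lt_of_limsup_lt h_bar)).and
    (M.eventually_ennMinDisc_ne_top (h_bar.trans_le le_top))
  refine ((frequently_lt_of_liminf_lt (by isBoundedDefault) h_rel).and_eventually
    (h_min.prod_inl (𝓝 x))).mono fun p ⟨hp_rel, ⟨hp, hp_bar⟩, hp_min⟩ => ?_
  exact M.exists_ennOneStep_smul_ennRelDisc_le p.2 hr hp.le hp_min <|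
    (add_le_add_right hp_bar.le _).trans_lt (lt_tsub_iff_right.1 hp_rel)

variable [TopologicalSpace A]

theorem WeaklyContinuous.tendsto_integral (hM : M.WeaklyContinuous) {p : ℕ → X × A} {p₀ : X × A}
    (hp : Tendsto p atTop (𝓝 p₀)) (hpG : ∀ n, p n ∈ M.graph) (hp₀ : p₀ ∈ M.graph) (f : X →ᵇ ℝ) :
    Tendsto (fun n => ∫ z, f z ∂(M.trans (p n))) atTop (𝓝 (∫ z, f z ∂(M.trans p₀))) :=
  (hM f p₀ hp₀).tendsto.comp (tendsto_nhdsWithin_iff.2 ⟨hp, .of_forall hpG⟩)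

variable [TopologicalSpace.MetrizableSpace X] [BorelSpace X] [TopologicalSpace.MetrizableSpace A]

theorem exists_mapClusterPt_ennOneStep_le (hr : KInfCompact M.actions r)
    (hM : M.WeaklyContinuous) {x : ℕ → X} {x₀ : X} (hx : Tendsto x atTop (𝓝 x₀)) {b : ℕ → A}
    (hb : ∀ n, b n ∈ M.actions (x n)) {f : ℕ → X → ℝ≥0∞} {g : X → ℝ≥0∞}
    (hg : ∀ y, g y ≤ liminf (fun p : ℕ × X => f p.1 p.2) (atTop ×ˢ 𝓝 y)) {C : ℝ≥0∞} (hC : C ≠ ⊤)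
    (hle : ∀ n, M.ennOneStep r (f n) (x n, b n) ≤ C) :
    ∃ b₀ ∈ M.actions x₀, MapClusterPt b₀ atTop b ∧ M.ennOneStep r g (x₀, b₀) ≤ C := by
  obtain ⟨b₀, hb₀, hcluster, -⟩ := hr hx hb hC fun n => le_self_add.trans (hle n)
  obtain ⟨ψ, hψ, hb_lim⟩ := hcluster.tendsto_subseq
  have hx_lim := hx.comp hψ.tendsto_atTop
  have hprob := M.isProbabilityMeasure_trans
  have h_int : ∫⁻ y, g y ∂(M.trans (x₀, b₀))
      ≤ liminf (fun n => ∫⁻ y, f (ψ n) y ∂(M.trans (x (ψ n), b (ψ n)))) atTop :=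
    lintegral_le_liminf_of_tendsto_integral
      (hM.tendsto_integral (hx_lim.prodMk_nhds hb_lim) (fun n => hb (ψ n)) hb₀)
      fun y => (hg y).trans <| liminf_le_liminf_of_le (u := fun p : ℕ × X => f p.1 p.2)
        (g := map (Prod.map ψ id) (atTop ×ˢ 𝓝 y)) (hψ.tendsto_atTop.prodMap tendsto_id)
  refine ⟨b₀, hb₀, hcluster, ?_⟩
  calc M.ennOneStep r g (x₀, b₀)
      ≤ liminf (fun n => r (x (ψ n), b (ψ n))) atTop
        + liminf (fun n => ∫⁻ y, f (ψ n) y ∂(M.trans (x (ψ n), b (ψ n)))) atTop :=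
        add_le_add (hr.le_liminf hx_lim hb_lim fun n => hb (ψ n)) h_int
    _ ≤ liminf (fun n => M.ennOneStep r (f (ψ n)) (x (ψ n), b (ψ n))) atTop :=
        liminf_add_liminf_le_liminf_add _ _
    _ ≤ C := liminf_le_of_frequently_le' (.of_forall fun n => hle (ψ n))

theorem kInfCompact_ennOneStep (hr : KInfCompact M.actions r) (hM : M.WeaklyContinuous)
    {u : X → ℝ≥0∞} (hu : LowerSemicontinuous u) :
    KInfCompact M.actions (M.ennOneStep r u) := fun _ _ hx _ hb _ hC hle =>
  exists_mapClusterPt_ennOneStep_le hr hM hx hb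
    (fun y => (hu.le_liminf y).trans (liminf_le_liminf_of_le tendsto_snd)) hC hle

theorem iInf_ennOneStep_ennRelLimit_le [BorelSpace A] (hr : KInfCompact M.actions r)
    (hr_meas : Measurable r) (hM : M.WeaklyContinuous) (x : X) :
    ⨅ b ∈ M.actions x, M.ennOneStep r (M.ennRelLimit r) (x, b)
      ≤ M.ennWBar r + M.ennRelLimit r x := by
  refine le_of_forall_gt_imp_ge_of_dense fun C hC => ?_
  rcases eq_or_ne C ⊤ with rfl | hC_top
  · exact le_top
  obtain ⟨p, hp, hp_le⟩ := frequently_iff_seq_forall.1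
    (frequently_exists_ennOneStep_smul_ennRelDisc_le hr_meas hC)
  choose b hb hb_le using hp_le
  have h_fst : Tendsto (fun n => (p n).1) atTop (𝓝[<] 1) := tendsto_fst.comp hp
  have h_snd : Tendsto (fun n => (p n).2) atTop (𝓝 x) := tendsto_snd.comp hp
  have h_limit := ennRelLimit_le_liminf_smul (M := M) (r := r) h_fst
  obtain ⟨b₀, hb₀, -, hb₀_le⟩ := exists_mapClusterPt_ennOneStep_le hr hM h_snd hb
    h_limit hC_top hb_le
  exact iInf₂_le_of_le b₀ hb₀ hb₀_le

end RelativeLimit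

end MDP

section LowerBy

open scoped NNReal

/-- The extended real `e - d`. Every quantity attached to a cost function bounded below by `-d` is
`lowerBy` of the same quantity for the nonnegative cost raised by `d`. -/
noncomputable def lowerBy (d : ℝ≥0) (e : ℝ≥0∞) : EReal := (e : EReal) - ((d : ℝ) : EReal)

variable (d : ℝ≥0)

theorem lowerBy_top : lowerBy d ⊤ = ⊤ := rfl

theorem lowerBy_coe (e : ℝ≥0) : lowerBy d e = ((e - d : ℝ) : EReal) := rfl

theorem lowerBy_zero_left (e : ℝ≥0∞) : lowerBy 0 e = e := by simp [lowerBy]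

variable {d}

theorem lowerBy_le_lowerBy {e e' : ℝ≥0∞} : lowerBy d e ≤ lowerBy d e' ↔ e ≤ e' := by
  refine ⟨fun h => ?_, fun h => EReal.sub_le_sub (by exact_mod_cast h) le_rfl⟩
  have := add_le_add_left h ((d : ℝ) : EReal)
  simpa only [lowerBy, EReal.sub_add_cancel, EReal.coe_ennreal_le_coe_ennreal_iff] using this

theorem lowerBy_lt_lowerBy {e e' : ℝ≥0∞} : lowerBy d e < lowerBy d e' ↔ e < e' := by
  rw [← not_le, lowerBy_le_lowerBy, not_le]

theorem lowerBy_lt_top {e : ℝ≥0∞} : lowerBy d e < ⊤ ↔ e < ⊤ := by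
  rw [← lowerBy_top d, lowerBy_lt_lowerBy]

variable (d) in
theorem monotone_lowerBy : Monotone (lowerBy d) := fun _ _ h => lowerBy_le_lowerBy.2 h

variable (d) in
theorem continuous_lowerBy : Continuous (lowerBy d) := by
  refine continuous_iff_continuousAt.2 fun e => ?_
  have h_add := EReal.continuousAt_add (p := ((e : EReal), -((d : ℝ) : EReal)))
    (Or.inr (by simp)) (Or.inr (by simp))
  exact ContinuousAt.comp (f := fun e : ℝ≥0∞ => ((e : EReal), -((d : ℝ) : EReal))) h_add
    (continuous_coe_ennreal_ereal.continuousAt.prodMk continuousAt_const)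

variable (d) in
theorem lowerBy_iInf {ι : Sort*} (f : ι → ℝ≥0∞) : lowerBy d (⨅ i, f i) = ⨅ i, lowerBy d (f i) :=
  Monotone.map_iInf_of_continuousAt (continuous_lowerBy d).continuousAt (monotone_lowerBy d)
    (lowerBy_top d)

variable (d) in
theorem lowerBy_limsup {ι : Type*} (l : Filter ι) [l.NeBot] (f : ι → ℝ≥0∞) :
    lowerBy d (limsup f l) = limsup (fun i => lowerBy d (f i)) l :=
  Monotone.map_limsup_of_continuousAt (monotone_lowerBy d) f (continuous_lowerBy d).continuousAt

theorem lowerBy_add_lowerBy (d d' : ℝ≥0) (e e' : ℝ≥0∞) :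
    lowerBy d e + lowerBy d' e' = lowerBy (d + d') (e + e') := by
  induction e with
  | top =>
    rw [top_add, lowerBy_top, lowerBy_top]
    induction e' with
    | top => rfl
    | coe e' => rw [lowerBy_coe, EReal.top_add_coe]
  | coe e =>
    induction e' with
    | top => rw [add_top, lowerBy_top, lowerBy_top, lowerBy_coe, EReal.coe_add_top]
    | coe e' =>
      rw [← ENNReal.coe_add, lowerBy_coe, lowerBy_coe, lowerBy_coe, ← EReal.coe_add]
      exact congrArg _ (by push_cast; ring)

theorem lowerBy_add_coe (d : ℝ≥0) (e e' : ℝ≥0∞) :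
    lowerBy d e + (e' : EReal) = lowerBy d (e + e') := by
  rw [← lowerBy_zero_left e', lowerBy_add_lowerBy, add_zero]

theorem mul_lowerBy (c d : ℝ≥0) (e : ℝ≥0∞) :
    ((c : ℝ) : EReal) * lowerBy d e = lowerBy (c * d) (c * e) := by
  induction e with
  | top =>
    rcases eq_or_ne c 0 with rfl | hc
    · simp [lowerBy]
    · rw [lowerBy_top, ENNReal.mul_top (by simpa using hc), lowerBy_top,
        EReal.coe_mul_top_of_pos (by simpa [pos_iff_ne_zero] using hc)]
  | coe e =>
    rw [← ENNReal.coe_mul, lowerBy_coe, lowerBy_coe, ← EReal.coe_mul]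
    exact congrArg _ (by push_cast; ring)

theorem lowerBy_sub_lowerBy {d m : ℝ≥0} {e : ℝ≥0∞} (h : m ≤ e) :
    lowerBy d e - lowerBy d m = ((e - m : ℝ≥0∞) : EReal) := by
  induction e with
  | top => rfl
  | coe e =>
    rw [lowerBy_coe, lowerBy_coe, ← ENNReal.coe_sub, EReal.coe_nnreal_eq_coe_real,
      NNReal.coe_sub (by exact_mod_cast h), ← EReal.coe_sub, sub_sub_sub_cancel_right]

theorem sum_lowerBy {ι : Type*} (s : Finset ι) (d : ι → ℝ≥0) (e : ι → ℝ≥0∞) :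
    ∑ i ∈ s, lowerBy (d i) (e i) = lowerBy (∑ i ∈ s, d i) (∑ i ∈ s, e i) := by
  classical
  induction s using Finset.induction_on with
  | empty => simp [lowerBy]
  | insert i s hi ih =>
    rw [Finset.sum_insert hi, Finset.sum_insert hi, Finset.sum_insert hi, ih, lowerBy_add_lowerBy]

theorem extIntegral_lowerBy {Ω : Type*} [MeasurableSpace Ω] {μ : Measure Ω}
    [IsProbabilityMeasure μ] {g : Ω → ℝ≥0∞} (hg : Measurable g) (d : ℝ≥0) :
    extIntegral μ (fun ω => lowerBy d (g ω)) = lowerBy d (∫⁻ ω, g ω ∂μ) := by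
  have h_const : ∫⁻ _, (d : ℝ≥0∞) ∂μ = d := by simp
  refine (extIntegral_coe_sub_coe hg measurable_const (fun _ => ENNReal.coe_ne_top)
    (h_const.trans_ne ENNReal.coe_ne_top)).trans ?_
  rw [h_const]
  rfl

theorem extSum_lowerBy {d : ℕ → ℝ≥0} (hd : Summable d) (e : ℕ → ℝ≥0∞) :
    extSum (fun n => lowerBy (d n) (e n)) = lowerBy (∑' n, d n) (∑' n, e n) := by
  have h_count : ∫⁻ n, (d n : ℝ≥0∞) ∂Measure.count = (∑' n, d n : ℝ≥0) := by
    rw [lintegral_count, ENNReal.coe_tsum hd]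
  rw [extSum_eq_extIntegral_count]
  refine (extIntegral_coe_sub_coe (measurable_of_countable e)
    (measurable_of_countable fun n => (d n : ℝ≥0∞)) (fun _ => ENNReal.coe_ne_top)
    (h_count.trans_ne ENNReal.coe_ne_top)).trans ?_
  rw [h_count, lintegral_count]
  rfl

theorem map_ofReal_nhdsLT {b : ℝ} (hb : 0 < b) :
    map ENNReal.ofReal (𝓝[<] b) = 𝓝[<] (ENNReal.ofReal b) := by
  have h_ofReal : Tendsto ENNReal.ofReal (𝓝[<] b) (𝓝[<] (ENNReal.ofReal b)) :=
    tendsto_nhdsWithin_of_tendsto_nhds_of_eventually_within _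
      (ENNReal.continuous_ofReal.continuousAt.mono_left nhdsWithin_le_nhds)
      (eventually_nhdsWithin_of_forall fun a ha => (ENNReal.ofReal_lt_ofReal_iff hb).2 ha)
  have h_toReal : Tendsto ENNReal.toReal (𝓝[<] (ENNReal.ofReal b)) (𝓝[<] b) := by
    refine tendsto_nhdsWithin_of_tendsto_nhds_of_eventually_within _ ?_
      (eventually_nhdsWithin_of_forall fun a ha => ?_)
    · have h_tendsto := ENNReal.tendsto_toReal (ENNReal.ofReal_ne_top (r := b))
      rw [ENNReal.toReal_ofReal hb.le] at h_tendsto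
      exact h_tendsto.mono_left nhdsWithin_le_nhds
    · exact (ENNReal.lt_ofReal_iff_toReal_lt (ne_top_of_lt ha)).1 ha
  have h_inv : ENNReal.ofReal ∘ ENNReal.toReal =ᶠ[𝓝[<] (ENNReal.ofReal b)] id :=
    eventually_nhdsWithin_of_forall fun a ha => ENNReal.ofReal_toReal (ne_top_of_lt ha)
  refine le_antisymm h_ofReal ?_
  calc 𝓝[<] (ENNReal.ofReal b)
      = map ENNReal.ofReal (map ENNReal.toReal (𝓝[<] (ENNReal.ofReal b))) := by
        rw [map_map, map_congr h_inv, map_id]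
    _ ≤ map ENNReal.ofReal (𝓝[<] b) := map_mono h_toReal

theorem map_ofReal_nhdsLT_one : map ENNReal.ofReal (𝓝[<] 1) = 𝓝[<] 1 := by
  simpa only [ENNReal.ofReal_one] using map_ofReal_nhdsLT one_pos

theorem eventually_nhdsLT_one_exists_coe_eq :
    ∀ᶠ α : ℝ in 𝓝[<] 1, ∃ a : ℝ≥0, a < 1 ∧ (a : ℝ) = α := by
  filter_upwards [Ioo_mem_nhdsLT one_pos] with α hα
  exact ⟨⟨α, hα.1.le⟩, hα.2, rfl⟩

theorem limsup_one_sub_mul_eq_lowerBy {L : ℝ≥0} {f : ℝ → EReal} {g : ℝ≥0∞ → ℝ≥0∞}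
    (h : ∀ a : ℝ≥0, a < 1 → f a = lowerBy ((1 - a)⁻¹ * L) (g a)) :
    limsup (fun α : ℝ => ((1 - α : ℝ) : EReal) * f α) (𝓝[<] 1)
      = lowerBy L (limsup (fun a : ℝ≥0∞ => (1 - a) * g a) (𝓝[<] 1)) := by
  rw [← map_ofReal_nhdsLT_one, ← limsup_comp, lowerBy_limsup]
  refine limsup_congr (eventually_nhdsLT_one_exists_coe_eq.mono ?_)
  rintro _ ⟨a, ha, rfl⟩
  have h_sub : (1 - a : ℝ) = ((1 - a : ℝ≥0) : ℝ) := by rw [NNReal.coe_sub ha.le, NNReal.coe_one]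
  rw [h a ha, h_sub, mul_lowerBy, ← mul_assoc, mul_inv_cancel₀ (tsub_pos_of_lt ha).ne', one_mul,
    Function.comp_apply, ENNReal.ofReal_coe_nnreal, ENNReal.coe_sub, ENNReal.coe_one]

end LowerBy

namespace MDP

section Reduction

open scoped NNReal

variable {X A : Type*} [MeasurableSpace X] [MeasurableSpace A]

/-- The cost raised by the constant `L`, as a function with values in `[0, ∞]` that vanishes
outside the graph. -/
noncomputable def raisedCost (M : MDP X A) (L : ℝ≥0) : X × A → ℝ≥0∞ :=
  M.graph.indicator fun p => (M.cost p + ((L : ℝ) : EReal)).toENNReal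

theorem measurable_raisedCost (M : MDP X A) (L : ℝ≥0) : Measurable (M.raisedCost L) := by
  have h_restrict : Measurable fun p : M.graph => (M.cost p + ((L : ℝ) : EReal)).toENNReal :=
    (M.measurable_cost.add_const _).ereal_toENNReal
  have h_graph : MeasurableSet M.graph := M.measurableSet_graph
  refine measurable_of_restrict_of_restrict_compl h_graph ?_ ?_
  · simpa only [Set.domRestrict_def, raisedCost, Set.indicator_of_mem (Subtype.prop _)]
      using h_restrict
  · have h_zero : ∀ p : ↥M.graphᶜ, M.raisedCost L p = 0 := fun p => Set.indicator_of_notMem p.2 _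
    simp only [Set.domRestrict_def, h_zero, measurable_const]

theorem exists_neg_le_cost (M : MDP X A) :
    ∃ L : ℝ≥0, ∀ p ∈ M.graph, -((L : ℝ) : EReal) ≤ M.cost p := by
  obtain ⟨K, hK⟩ := M.cost_bddBelow
  refine ⟨(-K).toNNReal, fun p hp => le_trans ?_ (hK p hp)⟩
  rw [← EReal.coe_neg, EReal.coe_le_coe_iff, Real.coe_toNNReal']
  exact neg_le_of_neg_le (le_max_left _ _)

variable {M : MDP X A} {L : ℝ≥0} (hL : ∀ p ∈ M.graph, -((L : ℝ) : EReal) ≤ M.cost p)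

include hL

theorem cost_eq_lowerBy {p : X × A} (hp : p ∈ M.graph) :
    M.cost p = lowerBy L (M.raisedCost L p) := by
  have h_nonneg : 0 ≤ M.cost p + ((L : ℝ) : EReal) := by
    rw [← neg_neg ((L : ℝ) : EReal), ← sub_eq_add_neg]
    exact EReal.sub_nonneg (by simp) (by simp) |>.2 (hL p hp)
  rw [lowerBy, raisedCost, Set.indicator_of_mem hp, EReal.coe_toENNReal h_nonneg,
    EReal.add_sub_cancel_right]

theorem oneStep_eq_lowerBy (u : X → ℝ≥0∞) {x : X} {b : A} (hb : b ∈ M.actions x) :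
    M.oneStep (fun y => (u y : EReal)) x b
      = lowerBy L (M.ennOneStep (M.raisedCost L) u (x, b)) := by
  rw [oneStep, cost_eq_lowerBy hL hb, extIntegral_coe, lowerBy_add_coe, ennOneStep]

variable [MeasurableSingletonClass X] [MeasurableSingletonClass A] (π : M.Policy) {a : ℝ≥0}

theorem horizonCost_eq_lowerBy (N : ℕ) (x : X) :
    M.horizonCost π N x = lowerBy (N * L) (M.ennHorizonCost (M.raisedCost L) π x N) := by
  have h_meas := M.measurable_raisedCost L
  have h_sum : ∀ᵐ ω ∂(M.pathMeasure π x), ∑ n ∈ Finset.range N, M.cost (ω n)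
      = lowerBy (N * L) (∑ n ∈ Finset.range N, M.raisedCost L (ω n)) := by
    filter_upwards [M.ae_mem_graph π x] with ω hω
    simp [cost_eq_lowerBy hL (hω _), sum_lowerBy]
  rw [horizonCost, extIntegral_congr_ae h_sum, extIntegral_lowerBy (by fun_prop), ennHorizonCost]

theorem discCost_eq_lowerBy (ha : a < 1) (x : X) :
    M.discCost π a x = lowerBy ((1 - a)⁻¹ * L) (M.ennDiscCost (M.raisedCost L) π a x) := by
  have h_meas := M.measurable_raisedCost L
  have h_summable : Summable fun n => a ^ n * L := (NNReal.summable_geometric ha).mul_right L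
  have h_sum : ∀ᵐ ω ∂(M.pathMeasure π x),
      (extSum fun n => (((a : ℝ) ^ n : ℝ) : EReal) * M.cost (ω n))
        = lowerBy ((1 - a)⁻¹ * L) (∑' n, (a : ℝ≥0∞) ^ n * M.raisedCost L (ω n)) := by
    filter_upwards [M.ae_mem_graph π x] with ω hω
    simp only [cost_eq_lowerBy hL (hω _), ← NNReal.coe_pow, mul_lowerBy]
    rw [extSum_lowerBy h_summable, NNReal.tsum_mul_right, NNReal.tsum_geometric ha]
    simp only [ENNReal.coe_pow]
  rw [discCost, extIntegral_congr_ae h_sum, extIntegral_lowerBy (by fun_prop), ennDiscCost]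

theorem avgCost_eq_lowerBy (x : X) :
    M.avgCost π x = lowerBy L (M.ennAvgCost (M.raisedCost L) π x) := by
  rw [avgCost, ennAvgCost, lowerBy_limsup]
  refine limsup_congr ((eventually_ge_atTop 1).mono fun N hN => ?_)
  have hN_ne : (N : ℝ≥0) ≠ 0 := Nat.cast_ne_zero.2 (by lia)
  have h_inv : ((N : ℝ)⁻¹ : ℝ) = ((N : ℝ≥0)⁻¹ : ℝ≥0) := by simp
  rw [horizonCost_eq_lowerBy hL, h_inv, mul_lowerBy, ← mul_assoc, inv_mul_cancel₀ hN_ne, one_mul,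
    ENNReal.coe_inv hN_ne, ENNReal.coe_natCast]

theorem discValue_eq_lowerBy (ha : a < 1) (x : X) :
    M.discValue a x = lowerBy ((1 - a)⁻¹ * L) (M.ennDiscValue (M.raisedCost L) a x) := by
  rw [discValue, ennDiscValue, lowerBy_iInf]
  exact iInf_congr fun π => discCost_eq_lowerBy hL π ha x

theorem minDisc_eq_lowerBy (ha : a < 1) :
    M.minDisc a = lowerBy ((1 - a)⁻¹ * L) (M.ennMinDisc (M.raisedCost L) a) := by
  rw [minDisc, ennMinDisc, lowerBy_iInf]
  exact iInf_congr fun x => discValue_eq_lowerBy hL ha x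

theorem relDisc_eq_coe (ha : a < 1) (hmin : M.ennMinDisc (M.raisedCost L) a ≠ ⊤) (x : X) :
    M.relDisc a x = (M.ennRelDisc (M.raisedCost L) a x : EReal) := by
  have h_le := M.ennMinDisc_le_ennDiscValue (M.raisedCost L) a x
  rw [relDisc, discValue_eq_lowerBy hL ha, minDisc_eq_lowerBy hL ha, ennRelDisc]
  lift M.ennMinDisc (M.raisedCost L) a to ℝ≥0 using hmin with m
  exact lowerBy_sub_lowerBy h_le

theorem wBar_eq_lowerBy : M.wBar = lowerBy L (M.ennWBar (M.raisedCost L)) :=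
  limsup_one_sub_mul_eq_lowerBy fun _ ha => minDisc_eq_lowerBy hL ha

theorem limsup_discValue_eq_lowerBy (x : X) :
    limsup (fun α : ℝ => ((1 - α : ℝ) : EReal) * M.discValue α x) (𝓝[<] 1)
      = lowerBy L (limsup (fun a : ℝ≥0∞ => (1 - a) * M.ennDiscValue (M.raisedCost L) a x)
        (𝓝[<] 1)) :=
  limsup_one_sub_mul_eq_lowerBy fun _ ha => discValue_eq_lowerBy hL ha x

end Reduction

section AverageCost

variable {X A : Type*} [MeasurableSpace X] [MeasurableSpace A] [MeasurableSingletonClass X]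
  [MeasurableSingletonClass A] {M : MDP X A}

theorem wBar_le_limsup_discValue (x : X) :
    M.wBar ≤ limsup (fun α : ℝ => ((1 - α : ℝ) : EReal) * M.discValue α x) (𝓝[<] 1) := by
  obtain ⟨L, hL⟩ := M.exists_neg_le_cost
  rw [wBar_eq_lowerBy hL, limsup_discValue_eq_lowerBy hL, lowerBy_le_lowerBy]
  exact M.ennWBar_le_limsup_ennDiscValue _ x

theorem limsup_discValue_le_avgValue (x : X) :
    limsup (fun α : ℝ => ((1 - α : ℝ) : EReal) * M.discValue α x) (𝓝[<] 1) ≤ M.avgValue x := by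
  obtain ⟨L, hL⟩ := M.exists_neg_le_cost
  refine le_iInf fun π => ?_
  rw [limsup_discValue_eq_lowerBy hL, avgCost_eq_lowerBy hL, lowerBy_le_lowerBy]
  exact M.limsup_ennDiscValue_le_ennAvgCost π x (M.measurable_raisedCost L)

theorem wBar_le_wStar : M.wBar ≤ M.wStar :=
  le_iInf fun x => (wBar_le_limsup_discValue x).trans (limsup_discValue_le_avgValue x)

variable {u : X → ℝ≥0∞} {φ : M.StationaryPolicy}

theorem avgCost_toPolicy_le_wBar
    (hφ : ∀ x, φ.toFun x ∈ M.acoiActions (fun y => (u y : EReal)) x) {x : X} (hx : u x ≠ ⊤) :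
    M.avgCost φ.toPolicy x ≤ M.wBar := by
  obtain ⟨L, hL⟩ := M.exists_neg_le_cost
  have h_acoi : ∀ x, M.ennOneStep (M.raisedCost L) u (x, φ.toFun x)
      ≤ M.ennWBar (M.raisedCost L) + u x := fun x => by
    simpa only [oneStep_eq_lowerBy hL _ (φ.mem_actions x), wBar_eq_lowerBy hL, lowerBy_add_coe,
      lowerBy_le_lowerBy] using (hφ x).2
  rw [avgCost_eq_lowerBy hL, wBar_eq_lowerBy hL, lowerBy_le_lowerBy]
  exact M.ennAvgCost_toPolicy_le x (M.measurable_raisedCost L) φ h_acoi hx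

theorem isAvgOptimal_of_mem_acoiActions
    (hφ : ∀ x, φ.toFun x ∈ M.acoiActions (fun y => (u y : EReal)) x) (hu : ∀ x, u x ≠ ⊤) :
    M.IsAvgOptimal φ.toPolicy ∧
      ∀ x, M.avgValue x = M.avgCost φ.toPolicy x ∧
        M.avgCost φ.toPolicy x
          = limsup (fun α : ℝ => ((1 - α : ℝ) : EReal) * M.discValue α x) (𝓝[<] 1) ∧
        limsup (fun α : ℝ => ((1 - α : ℝ) : EReal) * M.discValue α x) (𝓝[<] 1) = M.wBar ∧
        M.wBar = M.wStar := by
  have h_cost : ∀ x, M.avgCost φ.toPolicy x ≤ M.wBar := fun x =>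
    avgCost_toPolicy_le_wBar hφ (hu x)
  have h_value : ∀ x, M.avgValue x ≤ M.avgCost φ.toPolicy x := fun x => iInf_le _ _
  have h_disc : ∀ x, M.avgCost φ.toPolicy x
      ≤ limsup (fun α : ℝ => ((1 - α : ℝ) : EReal) * M.discValue α x) (𝓝[<] 1) := fun x =>
    (h_cost x).trans (wBar_le_limsup_discValue x)
  have h_eq : ∀ x, M.avgCost φ.toPolicy x = M.avgValue x := fun x =>
    le_antisymm ((h_disc x).trans (limsup_discValue_le_avgValue x)) (h_value x)
  refine ⟨h_eq, fun x => ⟨(h_eq x).symm, ?_, ?_, ?_⟩⟩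
  · exact le_antisymm (h_disc x) ((limsup_discValue_le_avgValue x).trans (h_value x))
  · exact le_antisymm ((limsup_discValue_le_avgValue x).trans ((h_value x).trans (h_cost x)))
      (wBar_le_limsup_discValue x)
  · exact le_antisymm wBar_le_wStar ((iInf_le _ x).trans ((h_value x).trans (h_cost x)))

end AverageCost

section RelLimitFinite

open scoped NNReal

variable {X A : Type*} [MeasurableSpace X] [MeasurableSpace A] [TopologicalSpace X] {M : MDP X A}

theorem relLimit_le_liminf_relDisc (M : MDP X A) (x : X) :
    M.relLimit x ≤ liminf (fun α : ℝ => M.relDisc α x) (𝓝[<] 1) :=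
  liminf_le_liminf_of_le (u := fun p : ℝ × X => M.relDisc p.1 p.2)
    (g := map (fun α => (α, x)) (𝓝[<] 1)) (tendsto_id.prodMk tendsto_const_nhds)

theorem AssumptionB.relLimit_lt_top (hB : M.AssumptionB) (x : X) : M.relLimit x < ⊤ :=
  (M.relLimit_le_liminf_relDisc x).trans_lt (hB.liminf_lt x)

variable [MeasurableSingletonClass X] [MeasurableSingletonClass A]

theorem relLimit_eq_coe {L : ℝ≥0} (hL : ∀ p ∈ M.graph, -((L : ℝ) : EReal) ≤ M.cost p)
    (hbar : M.wBar < ⊤) : M.relLimit = fun x => (M.ennRelLimit (M.raisedCost L) x : EReal) := by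
  rw [wBar_eq_lowerBy hL, lowerBy_lt_top] at hbar
  have h_min := M.eventually_ennMinDisc_ne_top hbar
  rw [← map_ofReal_nhdsLT_one, eventually_map] at h_min
  have h_relDisc : ∀ᶠ α : ℝ in 𝓝[<] 1, ∀ x,
      M.relDisc α x = (M.ennRelDisc (M.raisedCost L) (ENNReal.ofReal α) x : EReal) := by
    filter_upwards [h_min, eventually_nhdsLT_one_exists_coe_eq] with α hα ⟨a, ha, haα⟩ x
    subst haα
    rw [ENNReal.ofReal_coe_nnreal] at hα ⊢
    exact relDisc_eq_coe hL ha hα x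
  funext x
  calc M.relLimit x
      = liminf (fun p : ℝ × X =>
          (M.ennRelDisc (M.raisedCost L) (ENNReal.ofReal p.1) p.2 : EReal)) (𝓝[<] 1 ×ˢ 𝓝 x) :=
        liminf_congr ((h_relDisc.prod_inl _).mono fun p hp => hp p.2)
    _ = (liminf (fun p : ℝ × X =>
          M.ennRelDisc (M.raisedCost L) (ENNReal.ofReal p.1) p.2) (𝓝[<] 1 ×ˢ 𝓝 x) : ℝ≥0∞) :=
        (EReal.coe_ennreal_strictMono.monotone.map_liminf_of_continuousAt _
          continuous_coe_ennreal_ereal.continuousAt).symm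
    _ = M.ennRelLimit (M.raisedCost L) x := by
        rw [ennRelLimit, ← map_ofReal_nhdsLT_one, prod_map_left]
        rfl

theorem AssumptionB.exists_relLimit_eq_coe (hB : M.AssumptionB) :
    ∃ u : X → ℝ≥0∞, LowerSemicontinuous u ∧ (∀ x, u x ≠ ⊤) ∧
      M.relLimit = fun x => (u x : EReal) := by
  obtain ⟨L, hL⟩ := M.exists_neg_le_cost
  have h_eq := relLimit_eq_coe hL (wBar_le_wStar.trans_lt hB.general)
  refine ⟨_, lowerSemicontinuous_ennRelLimit, fun x => ?_, h_eq⟩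
  simpa only [h_eq, lt_top_iff_ne_top, ne_eq, EReal.coe_ennreal_eq_top_iff]
    using hB.relLimit_lt_top x

end RelLimitFinite

section Actions

open scoped NNReal

variable {X A : Type*} [MeasurableSpace X] [MeasurableSpace A] {M : MDP X A} {L : ℝ≥0}
  (hL : ∀ p ∈ M.graph, -((L : ℝ) : EReal) ≤ M.cost p)

include hL

theorem iInf_oneStep_eq_lowerBy (u : X → ℝ≥0∞) (x : X) :
    ⨅ b ∈ M.actions x, M.oneStep (fun y => (u y : EReal)) x b
      = lowerBy L (⨅ b ∈ M.actions x, M.ennOneStep (M.raisedCost L) u (x, b)) := by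
  simp only [lowerBy_iInf]
  exact iInf_congr fun b => iInf_congr fun hb => oneStep_eq_lowerBy hL u hb

theorem mem_minActions_iff (u : X → ℝ≥0∞) {x : X} {b : A} :
    b ∈ M.minActions (fun y => (u y : EReal)) x ↔
      b ∈ M.actions x ∧ M.ennOneStep (M.raisedCost L) u (x, b)
        = ⨅ b ∈ M.actions x, M.ennOneStep (M.raisedCost L) u (x, b) := by
  refine and_congr_right fun hb => ?_
  rw [iInf_oneStep_eq_lowerBy hL, oneStep_eq_lowerBy hL u hb, eq_comm, le_antisymm_iff,
    le_antisymm_iff, lowerBy_le_lowerBy, lowerBy_le_lowerBy]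

variable [MeasurableSingletonClass X] [MeasurableSingletonClass A]

theorem mem_acoiActions_iff (u : X → ℝ≥0∞) {x : X} {b : A} :
    b ∈ M.acoiActions (fun y => (u y : EReal)) x ↔
      b ∈ M.actions x ∧
        M.ennOneStep (M.raisedCost L) u (x, b) ≤ M.ennWBar (M.raisedCost L) + u x := by
  refine and_congr_right fun hb => ?_
  rw [oneStep_eq_lowerBy hL u hb, wBar_eq_lowerBy hL, lowerBy_add_coe, lowerBy_le_lowerBy]

end Actions

theorem measurableSet_acoiActions {X A : Type*} [MeasurableSpace X] [MeasurableSpace A]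
    [MeasurableSingletonClass X] [MeasurableSingletonClass A] {M : MDP X A} {u : X → ℝ≥0∞}
    (hu : Measurable u) :
    MeasurableSet {p : X × A | p.2 ∈ M.acoiActions (fun y => (u y : EReal)) p.1} := by
  obtain ⟨L, hL⟩ := M.exists_neg_le_cost
  have h_eq : {p : X × A | p.2 ∈ M.acoiActions (fun y => (u y : EReal)) p.1}
      = M.graph ∩ {p | M.raisedCost L p + ∫⁻ y, u y ∂(M.transKernel p)
        ≤ M.ennWBar (M.raisedCost L) + u p.1} := by
    ext p
    refine (mem_acoiActions_iff hL u).trans (and_congr_right fun hp => ?_)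
    rw [Set.mem_ofPred_eq, M.transKernel_apply hp, ennOneStep]
  rw [h_eq]
  exact M.measurableSet_graph.inter (measurableSet_le
    ((M.measurable_raisedCost L).add hu.lintegral_kernel)
    (measurable_const.add (hu.comp measurable_fst)))

section Topological

open scoped NNReal

variable {X A : Type*} [MeasurableSpace X] [MeasurableSpace A] [TopologicalSpace X]
  [TopologicalSpace A] {M : MDP X A}

theorem infCompactOn_of_infCompactOn_cost {u : X → ℝ≥0∞} (hu : LowerSemicontinuous u)
    (hbar : M.wBar < ⊤) (hne : ∀ x, (M.acoiActions (fun y => (u y : EReal)) x).Nonempty)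
    (hc : InfCompactOn M.cost M.graph) :
    InfCompactOn (fun x => (u x : EReal)) Set.univ := by
  intro ρ
  obtain ⟨w, hw, -⟩ := EReal.lt_iff_exists_real_btwn.1 hbar
  have h_closed : IsClosed {x | (u x : EReal) ≤ ρ} :=
    (continuous_coe_ennreal_ereal.comp_lowerSemicontinuous hu
      EReal.coe_ennreal_strictMono.monotone).isClosed_preimage _
  have h_compact := (hc (w + ρ)).image continuous_fst
  refine h_compact.of_isClosed_subset (by simpa using h_closed) fun x hx => ?_
  obtain ⟨b, hb, h_acoi⟩ := hne x
  refine ⟨(x, b), ⟨hb, ?_⟩, rfl⟩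
  calc M.cost (x, b) ≤ M.oneStep (fun y => (u y : EReal)) x b := by
        rw [oneStep, extIntegral_coe]
        exact le_add_of_nonneg_right (EReal.coe_ennreal_nonneg _)
    _ ≤ M.wBar + u x := h_acoi
    _ ≤ ((w + ρ : ℝ) : EReal) := by
        rw [EReal.coe_add]
        exact add_le_add hw.le hx.2

variable [TopologicalSpace.MetrizableSpace A]

theorem AssumptionWStar.kInfCompact_raisedCost (hW : M.AssumptionWStar) {L : ℝ≥0}
    (hL : ∀ p ∈ M.graph, -((L : ℝ) : EReal) ≤ M.cost p) :
    KInfCompact M.actions (M.raisedCost L) := by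
  intro x x₀ hx b hb C hC hle
  let := TopologicalSpace.metrizableSpaceMetric A
  have h_cost : ∀ n, M.cost (x n, b n) ≤ lowerBy L C := fun n => by
    rw [cost_eq_lowerBy hL (hb n), lowerBy_le_lowerBy]
    exact hle n
  obtain ⟨b₀, hb₀, h_cluster⟩ := hW.limit_point x x₀ hx b hb <| by
    lift C to ℝ≥0 using hC
    exact ⟨C - L, fun n => by simpa [lowerBy_coe] using h_cost n⟩
  refine ⟨b₀, hb₀, h_cluster, le_of_not_gt fun hlt => ?_⟩
  obtain ⟨ψ, hψ, h_lim⟩ := h_cluster.tendsto_subseq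
  rw [← lowerBy_lt_lowerBy (d := L), ← cost_eq_lowerBy hL hb₀] at hlt
  have h_graph : Tendsto (fun n => (x (ψ n), b (ψ n))) atTop (𝓝[M.graph] (x₀, b₀)) :=
    tendsto_nhdsWithin_iff.2 ⟨(hx.comp hψ.tendsto_atTop).prodMk_nhds h_lim,
      .of_forall fun n => hb (ψ n)⟩
  obtain ⟨n, hn⟩ := (h_graph.eventually (hW.lsc_cost _ hb₀ _ hlt)).exists
  exact hn.not_ge (h_cost _)

variable [TopologicalSpace.MetrizableSpace X] [BorelSpace X]

theorem AssumptionWStar.isCompact_acoiActions [MeasurableSingletonClass A]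
    (hW : M.AssumptionWStar) (hbar : M.wBar < ⊤) {u : X → ℝ≥0∞} (hu : LowerSemicontinuous u)
    {x : X} (hx : u x ≠ ⊤) : IsCompact (M.acoiActions (fun y => (u y : EReal)) x) := by
  obtain ⟨L, hL⟩ := M.exists_neg_le_cost
  rw [wBar_eq_lowerBy hL, lowerBy_lt_top] at hbar
  have h_compact := (kInfCompact_ennOneStep (hW.kInfCompact_raisedCost hL) hW.weak
    hu).isCompact_setOf_le x (ENNReal.add_ne_top.2 ⟨hbar.ne, hx⟩)
  exact (Set.ext fun b => mem_acoiActions_iff hL u) ▸ h_compact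

variable [BorelSpace A]

theorem AssumptionWStar.iInf_oneStep_relLimit_le (hW : M.AssumptionWStar) (hbar : M.wBar < ⊤)
    (x : X) : ⨅ b ∈ M.actions x, M.oneStep M.relLimit x b ≤ M.wBar + M.relLimit x := by
  obtain ⟨L, hL⟩ := M.exists_neg_le_cost
  rw [relLimit_eq_coe hL hbar, iInf_oneStep_eq_lowerBy hL, wBar_eq_lowerBy hL, lowerBy_add_coe,
    lowerBy_le_lowerBy]
  exact iInf_ennOneStep_ennRelLimit_le (hW.kInfCompact_raisedCost hL)
    (M.measurable_raisedCost L) hW.weak x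

theorem AssumptionWStar.exists_stationaryPolicy_mem_minActions [SecondCountableTopology A]
    (hW : M.AssumptionWStar) {u : X → ℝ≥0∞} (hu : LowerSemicontinuous u)
    (hfin : ∀ x, ⨅ b ∈ M.actions x, M.oneStep (fun y => (u y : EReal)) x b < ⊤) :
    ∃ φ : M.StationaryPolicy, ∀ x, φ.toFun x ∈ M.minActions (fun y => (u y : EReal)) x := by
  obtain ⟨L, hL⟩ := M.exists_neg_le_cost
  obtain ⟨f, hf, hmem⟩ := (kInfCompact_ennOneStep (hW.kInfCompact_raisedCost hL) hW.weak
    hu).exists_measurable_argmin fun x => by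
      have h_fin := hfin x
      rw [iInf_oneStep_eq_lowerBy hL, lowerBy_lt_top] at h_fin
      exact h_fin.ne
  exact ⟨⟨f, hf, fun x => (hmem x).1⟩, fun x => (mem_minActions_iff hL u).2 (hmem x)⟩

end Topological

end MDP

theorem mainTheorem1_general
    {X A : Type*} [TopologicalSpace X] [TopologicalSpace.MetrizableSpace X] [MeasurableSpace X]
    [BorelSpace X] [TopologicalSpace A] [TopologicalSpace.MetrizableSpace A]
    [SecondCountableTopology A] [MeasurableSpace A] [BorelSpace A]
    (M : MDP X A) (hW : M.AssumptionWStar) (hB : M.AssumptionB) :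
    (∃ φ : M.StationaryPolicy,
      (∀ x, M.oneStep M.relLimit x (φ.toFun x) ≤ M.wBar + M.relLimit x) ∧
      M.IsAvgOptimal φ.toPolicy ∧
      ∀ x, M.avgValue x = M.avgCost φ.toPolicy x ∧
        M.avgCost φ.toPolicy x
          = limsup (fun α : ℝ => ((1 - α : ℝ) : EReal) * M.discValue α x) (𝓝[<] 1) ∧
        limsup (fun α : ℝ => ((1 - α : ℝ) : EReal) * M.discValue α x) (𝓝[<] 1) = M.wBar ∧
        M.wBar = M.wStar) ∧
    ((∀ x, 0 ≤ M.relLimit x ∧ M.relLimit x < ⊤) ∧ LowerSemicontinuous M.relLimit) ∧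
    ((∀ x, (M.acoiActions M.relLimit x).Nonempty) ∧
      MeasurableSet {p : X × A | p.2 ∈ M.acoiActions M.relLimit p.1} ∧
      ∀ x, IsCompact (M.acoiActions M.relLimit x)) ∧
    (∀ φ : M.StationaryPolicy, (∀ x, φ.toFun x ∈ M.acoiActions M.relLimit x) →
      (∀ x, M.oneStep M.relLimit x (φ.toFun x) ≤ M.wBar + M.relLimit x) ∧
      M.IsAvgOptimal φ.toPolicy ∧
      ∀ x, M.avgValue x = M.avgCost φ.toPolicy x ∧
        M.avgCost φ.toPolicy x
          = limsup (fun α : ℝ => ((1 - α : ℝ) : EReal) * M.discValue α x) (𝓝[<] 1) ∧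
        limsup (fun α : ℝ => ((1 - α : ℝ) : EReal) * M.discValue α x) (𝓝[<] 1) = M.wBar ∧
        M.wBar = M.wStar) ∧
    ((∀ x, M.minActions M.relLimit x ⊆ M.acoiActions M.relLimit x) ∧
      ∃ φ : M.StationaryPolicy, ∀ x, φ.toFun x ∈ M.minActions M.relLimit x) ∧
    (M.AssumptionWu → InfCompactOn M.relLimit Set.univ) := by
  have hbar : M.wBar < ⊤ := MDP.wBar_le_wStar.trans_lt hB.general
  have h_acoi := hW.iInf_oneStep_relLimit_le hbar
  have h_fin := hB.relLimit_lt_top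
  have h_lsc : LowerSemicontinuous M.relLimit := lowerSemicontinuous_liminf_prod_nhds _ _
  obtain ⟨u, hu, hu_top, h_eq⟩ := hB.exists_relLimit_eq_coe
  rw [h_eq] at h_acoi h_fin h_lsc ⊢
  have h_min_subset : ∀ x, M.minActions (fun y => (u y : EReal)) x
      ⊆ M.acoiActions (fun y => (u y : EReal)) x := fun x b hb =>
    ⟨hb.1, hb.2.symm.le.trans (h_acoi x)⟩
  obtain ⟨φ, hφ⟩ := hW.exists_stationaryPolicy_mem_minActions hu fun x =>
    (h_acoi x).trans_lt (EReal.add_lt_top hbar.ne (h_fin x).ne)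
  have hφ_acoi := fun x => h_min_subset x (hφ x)
  have h_optimal := fun (φ : M.StationaryPolicy)
      (hφ : ∀ x, φ.toFun x ∈ M.acoiActions (fun y => (u y : EReal)) x) =>
    And.intro (fun x => (hφ x).2) (MDP.isAvgOptimal_of_mem_acoiActions hφ hu_top)
  exact ⟨⟨φ, h_optimal φ hφ_acoi⟩,
    ⟨fun x => ⟨EReal.coe_ennreal_nonneg _, h_fin x⟩, h_lsc⟩,
    ⟨fun x => ⟨_, hφ_acoi x⟩, MDP.measurableSet_acoiActions hu.measurable,
      fun x => hW.isCompact_acoiActions hbar hu (hu_top x)⟩,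
    h_optimal, ⟨h_min_subset, φ, hφ⟩,
    fun hWu => MDP.infCompactOn_of_infCompactOn_cost hu hbar
      (fun x => ⟨_, hφ_acoi x⟩) hWu.infCompact_cost⟩

theorem mainTheorem1
    {E F : Type*} [TopologicalSpace E] [PolishSpace E] [MeasurableSpace E] [BorelSpace E]
    [TopologicalSpace F] [PolishSpace F] [MeasurableSpace F] [BorelSpace F]
    (X : Set E) (hX : MeasurableSet X) (A : Set F) (hA : MeasurableSet A)
    (M : MDP X A) (hW : M.AssumptionWStar) (hB : M.AssumptionB) :
    -- there is a stationary policy that satisfies the optimality inequality, is average-cost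
    -- optimal and attains the common value
    (∃ φ : M.StationaryPolicy,
      (∀ x, M.oneStep M.relLimit x (φ.toFun x) ≤ M.wBar + M.relLimit x) ∧
      M.IsAvgOptimal φ.toPolicy ∧
      ∀ x, M.avgValue x = M.avgCost φ.toPolicy x ∧
        M.avgCost φ.toPolicy x
          = limsup (fun α : ℝ => ((1 - α : ℝ) : EReal) * M.discValue α x) (𝓝[<] 1) ∧
        limsup (fun α : ℝ => ((1 - α : ℝ) : EReal) * M.discValue α x) (𝓝[<] 1) = M.wBar ∧
        M.wBar = M.wStar) ∧
    -- (a)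
    ((∀ x, 0 ≤ M.relLimit x ∧ M.relLimit x < ⊤) ∧ LowerSemicontinuous M.relLimit) ∧
    -- (b)
    ((∀ x, (M.acoiActions M.relLimit x).Nonempty) ∧
      MeasurableSet {p : X × A | p.2 ∈ M.acoiActions M.relLimit p.1} ∧
      ∀ x, IsCompact (M.acoiActions M.relLimit x)) ∧
    -- (c)
    (∀ φ : M.StationaryPolicy, (∀ x, φ.toFun x ∈ M.acoiActions M.relLimit x) →
      (∀ x, M.oneStep M.relLimit x (φ.toFun x) ≤ M.wBar + M.relLimit x) ∧
      M.IsAvgOptimal φ.toPolicy ∧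
      ∀ x, M.avgValue x = M.avgCost φ.toPolicy x ∧
        M.avgCost φ.toPolicy x
          = limsup (fun α : ℝ => ((1 - α : ℝ) : EReal) * M.discValue α x) (𝓝[<] 1) ∧
        limsup (fun α : ℝ => ((1 - α : ℝ) : EReal) * M.discValue α x) (𝓝[<] 1) = M.wBar ∧
        M.wBar = M.wStar) ∧
    -- (d)
    ((∀ x, M.minActions M.relLimit x ⊆ M.acoiActions M.relLimit x) ∧
      ∃ φ : M.StationaryPolicy, ∀ x, φ.toFun x ∈ M.minActions M.relLimit x) ∧
    -- (e)
    (M.AssumptionWu → InfCompactOn M.relLimit Set.univ) :=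
  mainTheorem1_general M hW hB
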